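/- Let $(\Omega,\mathcal F,(\mathcal F_t)_{t\ge0},\mathbb P)$ be a filtered probability space with $\mathbb P$-trivial $\mathcal F_0$, let $P^0$ be a càdlàg $(\mathcal F_t)$-martingale (the unaffected price), let $\gamma>0$ and $\eta>0$, and let the temporary impact be $h(x)=\eta x$. Let $0<\tau_1<\tau_2<\cdots$ be random times (arrivals of matching orders in a dark pool) whose counting process $N_t=\max\{k:\tau_k\le t\}$ (with $N_t=0$ if $\tau_1>t$) is finite-valued and a Poisson process with parameter $\theta>0$. Let the sizes $\widetilde Y_1,\widetilde Y_2,\dots$ of the matching orders be i.i.d. with a law $\mu$ on $(0,\infty]$ such that $\mu([x,\infty])>0$ for all $x>0$, and let $P^0$, $N$ and $(\widetilde Y_i)$ be independent. *Strategies.* For $\widehat X\in\mathbb R$ and $\Xi\in[0,|\widehat X|]$ put $S_0=0$, $S_i=S_{i-1}+Y_i$ and $$Y_i=\begin{cases}\operatorname{sgn}(\widehat X)\,\widetilde Y_i,&\widetilde Y_i\ge\Xi,\ |S_{i-1}|+\widetilde Y_i\le|\widehat X|,\\ \widehat X-S_{i-1},&\widetilde Y_i\ge\Xi,\ |S_{i-1}|+\widetilde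 Y_i>|\widehat X|,\\ 0,&\widetilde Y_i<\Xi,\end{cases}\qquad Z_t=\sum_{i=1}^{N_t}Y_i .$$ Let $(\mathcal G_t)$ be the right-continuous filtration generated by $(\mathcal F_t)$, $Z$ and $(\tau_i\wedge t)_{t\ge0}$, $i\ge1$. For $X_0\in\mathbb R$ and $T>0$ let $\mathcal X(X_0,T)$ be the set of all $\chi=(\widehat X,\Xi,\xi,\rho)$, where $\widehat X\in\mathbb R$, $\Xi\in[0,|\widehat X|]$, $\rho$ is a $(\mathcal G_t)$-stopping time with $\rho<T$ a.s., and $\xi$ is a $(\mathcal G_t)$-predictable process, a.s. integrable on $[0,T]$, such that $\int_0^t\xi_s\,ds$ is a.s. bounded uniformly in $t\in[0,T]$ and $\omega$, and such that $X_0+\int_0^T\xi_t\,dt+Z_\rho=0$ a.s. *Costs.* With zero slippage and no cross-venue impact ($\alpha=\beta=\kappa=0$), the costs of $\chi\in\mathcal X(X_0,T)$ are $$\mathcal C^\chi_T=X_0P^0_0+\int_0^T\xi_t\Big(P^0_t+\gamma\int_0^t\xi_s\,ds+\eta\xi_t\Big)dt+\sum_{i=1}^{N_\rho}Y_i\Big(P^0_{\tau_i}+\gamma\int_0^{\tau_i}\xi_s\,ds\Big)\in(-\infty,\infty],$$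 where the first integral is $+\infty$ if it does not converge absolutely. Expectations are understood in $[-\infty,\infty]$ as $\mathbb E[C^+]-\mathbb E[C^-]$; strategies for which both terms are infinite are disregarded in the infima below. Then the following holds. (a) If $\frac\gamma\eta<2\theta$, then for every $X_0\in\mathbb R\setminus\{0\}$ the following limit exists in $[-\infty,\infty]$ and satisfies $$\lim_{T\uparrow\infty}\ \inf_{\chi\in\mathcal X(X_0,T)}\mathbb E[\,\mathcal C^\chi_T\,]\ \le\ -\frac{\gamma^2}{2}X_0^2\,\frac1{2\eta\theta-\gamma}\ <\ 0 .$$ (b) If either $\frac\gamma\eta=2\theta$ and $X_0\ne0$, or $\frac\gamma\eta>2\theta$ (and $X_0\in\mathbb R$ is arbitrary), then $$\lim_{T\uparrow\infty}\ \inf_{\chi\in\mathcal X(X_0,T)}\mathbb E[\,\mathcal C^\chi_T\,]=-\infty .$$ -/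

import Mathlib

open MeasureTheory ProbabilityTheory Filter Topology
open scoped NNReal ENNReal

noncomputable section

namespace DarkPool

/-- The integral `∫_0^t f(s) ds` of a function of nonnegative time. -/
def timeIntegral (f : ℝ≥0 → ℝ) (t : ℝ≥0) : ℝ :=
  ∫ s in (0 : ℝ)..(t : ℝ), f s.toNNReal

/-- `∫_0^t |f(s)| ds` is finite (and `f` is measurable on `[0, t]`). -/
def TimeIntegrable (f : ℝ≥0 → ℝ) (t : ℝ≥0) : Prop :=
  IntervalIntegrable (fun s : ℝ => f s.toNNReal) volume 0 t

/-- Impact functions. -/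
structure IsImpactFunction (h : ℝ → ℝ) : Prop where
  continuous : Continuous h
  strictMono : StrictMono h
  map_zero : h 0 = 0
  convex : ConvexOn ℝ Set.univ (fun x => x * h x)

/-- All paths are right-continuous and have left limits. -/
def IsCadlag {Ω : Type*} (X : ℝ≥0 → Ω → ℝ) : Prop :=
  ∀ ω t, ContinuousWithinAt (fun s => X s ω) (Set.Ioi t) t ∧
    ∃ l : ℝ, Tendsto (fun s => X s ω) (𝓝[<] t) (𝓝 l)

/-- The number `N_t` of arrivals until time `t`, for arrival times
`τ 0 < τ 1 < ...` (the `k`-th arrival is `τ (k - 1)`). -/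
def arrivalCount {Ω : Type*} (τ : ℕ → Ω → ℝ≥0) (t : ℝ≥0) (ω : Ω) : ℕ :=
  {i : ℕ | τ i ω ≤ t}.ncard

/-- A Poisson process with parameter `θ`: it starts in `0` and its increments are independent, the
one over `[s, t]` having the Poisson distribution with mean `θ (t - s)`. -/
structure IsPoissonProcess {Ω : Type*} [MeasurableSpace Ω] (N : ℝ≥0 → Ω → ℕ) (θ : ℝ≥0)
    (μ : Measure Ω) : Prop where
  zero : ∀ᵐ ω ∂μ, N 0 ω = 0
  indep : HasIndepIncrements N μ
  law : ∀ s t : ℝ≥0, s ≤ t →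
    HasLaw (fun ω => N t ω - N s ω) (poissonMeasure (θ * (t - s))) μ

/-- The part of an incoming order of size `y` that is executed against a dark-pool order of (signed)
size `Xhat` with minimum quantity level `Xi`, when the (signed) amount `s` of it has already been
filled. -/
def fill (Xhat Xi s : ℝ) (y : ℝ≥0∞) : ℝ :=
  if ENNReal.ofReal Xi ≤ y then
    if ENNReal.ofReal |s| + y ≤ ENNReal.ofReal |Xhat| then SignType.sign Xhat * y.toReal
    else Xhat - s
  else 0

/-- The signed amount of the order that has been filled by the first `k` incoming orders, whose
sizes are `y 0, ..., y (k - 1)`. -/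
def filled (Xhat Xi : ℝ) (y : ℕ → ℝ≥0∞) : ℕ → ℝ
  | 0 => 0
  | k + 1 => filled Xhat Xi y k + fill Xhat Xi (filled Xhat Xi y k) (y k)

lemma measurable_fill (Xhat Xi : ℝ) : Measurable (fun p : ℝ × ℝ≥0∞ => fill Xhat Xi p.1 p.2) := by
  unfold fill
  refine Measurable.ite (measurableSet_le measurable_const measurable_snd) ?_ measurable_const
  refine Measurable.ite (measurableSet_le ?_ measurable_const) ?_ ?_ <;> fun_prop

lemma measurable_filled (Xhat Xi : ℝ) (k : ℕ) : Measurable (fun y => filled Xhat Xi y k) := by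
  induction k with
  | zero => exact measurable_const
  | succ k ih =>
    exact ih.add ((measurable_fill Xhat Xi).comp (ih.prodMk (measurable_pi_apply k)))

/-- A price impact model of Almgren-Chriss type together with its dark-pool extension, on a
probability space `(Ω, μ)`. Arrival times and order sizes are indexed from `0`. -/
structure Model {Ω : Type*} [mΩ : MeasurableSpace Ω] (μ : Measure Ω) where
  /-- The filtration of the price process. -/
  F : Filtration ℝ≥0 mΩ
  trivial_zero : ∀ A, MeasurableSet[F 0] A → μ A = 0 ∨ μ A = 1
  /-- The unaffected price process. -/
  P0 : ℝ≥0 → Ω → ℝ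
  martingale : Martingale P0 F μ
  cadlag : IsCadlag P0
  /-- The permanent-impact parameter. -/
  γ : ℝ
  γ_pos : 0 < γ
  /-- The temporary-impact function. -/
  h : ℝ → ℝ
  impact : IsImpactFunction h
  /-- The virtual permanent impact of dark-pool executions. -/
  α : ℝ
  α_mem : α ∈ Set.Icc (0 : ℝ) 1
  /-- The slippage of dark-pool executions. -/
  β : ℝ → ℝ
  /-- The temporary cross-venue impact. -/
  κ : ℝ
  κ_nonneg : 0 ≤ κ
  /-- The arrival times of matching orders in the dark pool. -/
  τ : ℕ → Ω → ℝ≥0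
  measurable_τ : ∀ i, Measurable (τ i)
  τ_pos : ∀ ω, 0 < τ 0 ω
  τ_strictMono : ∀ ω, StrictMono (fun i => τ i ω)
  τ_finite : ∀ ω t, {i : ℕ | τ i ω ≤ t}.Finite
  /-- The sizes of the incoming matching orders. -/
  Ytilde : ℕ → Ω → ℝ≥0∞
  measurable_Ytilde : ∀ i, Measurable (Ytilde i)

namespace Model

variable {Ω : Type*} [mΩ : MeasurableSpace Ω] {μ : Measure Ω} (M : Model μ)

/-- The counting process `N` of the arrival times. -/
def N (t : ℝ≥0) (ω : Ω) : ℕ := arrivalCount M.τ t ω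

/-- The executed part `Y_i` of the `i`-th incoming order. -/
def Y (Xhat Xi : ℝ) (i : ℕ) (ω : Ω) : ℝ :=
  fill Xhat Xi (filled Xhat Xi (fun j => M.Ytilde j ω) i) (M.Ytilde i ω)

/-- The amount of shares executed in the dark pool until time `t` (without cancellation). -/
def Z (Xhat Xi : ℝ) (t : ℝ≥0) (ω : Ω) : ℝ :=
  ∑ i ∈ Finset.range (M.N t ω), M.Y Xhat Xi i ω

lemma N_le_iff (t : ℝ≥0) (ω : Ω) (n : ℕ) : M.N t ω ≤ n ↔ t < M.τ n ω := by
  have hfin := M.τ_finite ω t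
  have hmono := M.τ_strictMono ω
  constructor
  · intro hle
    by_contra hcon
    have hsub : (Finset.range (n + 1) : Set ℕ) ⊆ {i : ℕ | M.τ i ω ≤ t} := by
      intro i hi
      have : i ≤ n := by simpa [Nat.lt_succ_iff] using hi
      exact (hmono.monotone this).trans (not_lt.mp hcon)
    have h2 := Set.ncard_le_ncard hsub hfin
    rw [Set.ncard_coe_finset, Finset.card_range] at h2
    have : M.N t ω = {i : ℕ | M.τ i ω ≤ t}.ncard := rfl
    omega
  · intro hlt
    have hsub : {i : ℕ | M.τ i ω ≤ t} ⊆ (Finset.range n : Set ℕ) := by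
      intro i hi
      have hi' : M.τ i ω ≤ t := hi
      have : i < n := hmono.lt_iff_lt.mp (hi'.trans_lt hlt)
      simpa using this
    have h2 := Set.ncard_le_ncard hsub (Finset.finite_toSet _)
    rwa [Set.ncard_coe_finset, Finset.card_range] at h2

lemma measurable_N (t : ℝ≥0) : Measurable (M.N t) := by
  refine measurable_of_Iic fun n => ?_
  have : M.N t ⁻¹' Set.Iic n = {ω | t < M.τ n ω} := by
    ext ω
    exact M.N_le_iff t ω n
  rw [this]
  exact measurableSet_lt measurable_const (M.measurable_τ n)

lemma measurable_Y (Xhat Xi : ℝ) (i : ℕ) : Measurable (M.Y Xhat Xi i) := by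
  have hy : Measurable fun ω j => M.Ytilde j ω := measurable_pi_lambda _ M.measurable_Ytilde
  exact (measurable_fill Xhat Xi).comp
    (((measurable_filled Xhat Xi i).comp hy).prodMk (M.measurable_Ytilde i))

lemma measurable_Z (Xhat Xi : ℝ) (t : ℝ≥0) : Measurable (M.Z Xhat Xi t) := by
  have h1 : Measurable fun p : Ω × ℕ => ∑ i ∈ Finset.range p.2, M.Y Xhat Xi i p.1 :=
    measurable_from_prod_countable_left fun n =>
      Finset.measurable_fun_sum (Finset.range n) fun i _ => M.measurable_Y Xhat Xi i
  exact h1.comp (measurable_id.prodMk (M.measurable_N t))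

/-- The right-continuous filtration generated by `F`, by `Z` and by `(τ_i ∧ t)` for all `i`. -/
def G (Xhat Xi : ℝ) : Filtration ℝ≥0 mΩ :=
  (M.F ⊔ Filtration.natural (M.Z Xhat Xi) (fun t => (M.measurable_Z Xhat Xi t).stronglyMeasurable) ⊔
    ⨆ i : ℕ, Filtration.natural (fun t ω => min (M.τ i ω) t)
      (fun _ => ((M.measurable_τ i).min measurable_const).stronglyMeasurable)).rightCont

end Model

/-- The data of a trading strategy: the dark-pool order `Xhat`, its minimum quantity level `Xi`, the
speed of trading `ξ` at the exchange, the cancellation time `ρ` of the dark-pool order. -/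
structure Strategy (Ω : Type*) where
  Xhat : ℝ
  Xi : ℝ
  ξ : ℝ≥0 → Ω → ℝ
  ρ : Ω → ℝ≥0

namespace Model

variable {Ω : Type*} [mΩ : MeasurableSpace Ω] {μ : Measure Ω} (M : Model μ)

/-- Admissible strategies for the initial position `X₀` and the time horizon `T`. -/
structure IsAdmissible (X₀ : ℝ) (T : ℝ≥0) (χ : Strategy Ω) : Prop where
  Xi_mem : χ.Xi ∈ Set.Icc 0 |χ.Xhat|
  stopping : IsStoppingTime (M.G χ.Xhat χ.Xi) (fun ω => (χ.ρ ω : WithTop ℝ≥0))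
  lt_horizon : ∀ᵐ ω ∂μ, χ.ρ ω < T
  predictable : IsStronglyPredictable (M.G χ.Xhat χ.Xi) χ.ξ
  integrable : ∀ᵐ ω ∂μ, TimeIntegrable (fun s => χ.ξ s ω) T
  bounded : ∃ K : ℝ, ∀ᵐ ω ∂μ, ∀ t ≤ T, |timeIntegral (fun s => χ.ξ s ω) t| ≤ K
  liquidation : ∀ᵐ ω ∂μ,
    X₀ + timeIntegral (fun s => χ.ξ s ω) T + M.Z χ.Xhat χ.Xi (χ.ρ ω) ω = 0

/-- The price at the exchange. -/
def exchangePrice (χ : Strategy Ω) (t : ℝ≥0) (ω : Ω) : ℝ :=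
  M.P0 t ω + M.γ * timeIntegral (fun s => χ.ξ s ω) t + M.h (χ.ξ t ω)

/-- The price at which the `i`-th incoming order is executed in the dark pool. -/
def darkPrice (χ : Strategy Ω) (i : ℕ) (ω : Ω) : ℝ :=
  M.P0 (M.τ i ω) ω + M.γ * timeIntegral (fun s => χ.ξ s ω) (M.τ i ω)
    + M.κ * M.h (χ.ξ (M.τ i ω) ω)

/-- The expenses `∫_0^T ξ_t P_t dt` of trading at the exchange. Since `ξ_t h(ξ_t) ≥ 0`, the integral
of an admissible strategy has the value `+∞` when it does not converge absolutely. -/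
def exchangeExpense (T : ℝ≥0) (χ : Strategy Ω) (ω : Ω) : EReal :=
  open scoped Classical in
  if TimeIntegrable (fun t => χ.ξ t ω * M.exchangePrice χ t ω) T then
    ((timeIntegral (fun t => χ.ξ t ω * M.exchangePrice χ t ω) T : ℝ) : EReal)
  else ⊤

/-- The costs of a strategy. The left limit of `Z` at the `i`-th arrival time is the sum of the
earlier executions. -/
def cost (X₀ : ℝ) (T : ℝ≥0) (χ : Strategy Ω) (ω : Ω) : EReal :=
  M.exchangeExpense T χ ω +
    ((X₀ * M.P0 0 ω
      + M.α * M.γ * timeIntegral (fun t => M.Z χ.Xhat χ.Xi (min (χ.ρ ω) t) ω * χ.ξ t ω) T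
      + ∑ i ∈ Finset.range (M.N (χ.ρ ω) ω), M.Y χ.Xhat χ.Xi i ω *
          (M.darkPrice χ i ω + M.α * M.γ * ∑ j ∈ Finset.range i, M.Y χ.Xhat χ.Xi j ω
            + M.β (M.Y χ.Xhat χ.Xi i ω)) : ℝ) : EReal)

end Model

/-- The expectation of an extended-real random variable, as the difference of the expectations of
its positive and negative parts, with value `+∞` when both of them are infinite. -/
def expectation {Ω : Type*} [MeasurableSpace Ω] (μ : Measure Ω) (C : Ω → EReal) : EReal :=
  open scoped Classical in
  if ∫⁻ ω, (C ω).toENNReal ∂μ = ⊤ ∧ ∫⁻ ω, (-C ω).toENNReal ∂μ = ⊤ then ⊤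
  else ((∫⁻ ω, (C ω).toENNReal ∂μ : ℝ≥0∞) : EReal) - ((∫⁻ ω, (-C ω).toENNReal ∂μ : ℝ≥0∞) : EReal)

namespace Model

variable {Ω : Type*} [mΩ : MeasurableSpace Ω] {μ : Measure Ω} (M : Model μ)

/-- The infimum of the expected costs over all admissible strategies. -/
def infExpectedCost (X₀ : ℝ) (T : ℝ≥0) : EReal :=
  ⨅ χ : {χ : Strategy Ω // M.IsAdmissible X₀ T χ}, expectation μ (M.cost X₀ T χ.1)

/-- Poisson arrivals with parameter `θ > 0` and i.i.d. order sizes with values in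
`(0, ∞]` that are unbounded from above, such that prices, arrivals and sizes are independent. -/
structure PoissonArrivals (θ : ℝ≥0) (ν : Measure ℝ≥0∞) : Prop where
  θ_pos : 0 < θ
  poisson : IsPoissonProcess M.N θ μ
  size_law : ∀ i, μ.map (M.Ytilde i) = ν
  size_indep : iIndepFun M.Ytilde μ
  size_pos : ν {0} = 0
  size_unbounded : ∀ x : ℝ≥0, 0 < x → 0 < ν (Set.Ici (x : ℝ≥0∞))
  indep : iIndep ![MeasurableSpace.comap (fun ω t => M.P0 t ω) inferInstance,
    MeasurableSpace.comap (fun ω t => M.N t ω) inferInstance,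
    MeasurableSpace.comap (fun ω i => M.Ytilde i ω) inferInstance] μ

end Model

end DarkPool

end

namespace DarkPool

/-! Both parts come from one family of price manipulations. Place an all-or-nothing dark-pool order
of signed size `x`, trade at the exchange at constant speed `c` until the first arrival (or time
`S`), stay idle until `S`, then close the remaining position at constant speed during `(S, T]`. The
exchange trades move the price at which the dark order executes, while the dark execution itself
moves no price. So trading against the sign of `x` makes the dark fill cheaper, by an amount that
can exceed the impact costs.

In expectation the unaffected price drops out: it is a martingale independent of arrivals and sizes,
so each share traded costs its mean, and `X₀` plus all trades is zero (`integral_exchange`,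
`integral_dark`). Permanent impact at the exchange costs `γ/2` times the square of the total
exchange trade, which is `-(X₀ + Z_S)`; the exit's temporary impact is `O(1/(T - S))`. Let `T → ∞`,
then `S → ∞`. Sizes are unbounded, so the order is eventually filled, and the first arrival has mean
`1/θ`. The limiting cost is `γ/2 (X₀ + x)² + (η c² + γ c x)/θ`, and minimising over `c` leaves `γ/2
(X₀ + x)² - γ² x²/(4ηθ)` (`iInf_infExpectedCost_le`).

This is a quadratic in `x` with leading coefficient `γ/2 (1 - γ/(2ηθ))`. If that is positive, its
minimum is the bound in (a). If it is negative, or zero with `X₀ ≠ 0`, the quadratic is unbounded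
below, which is (b). The limit in `T` exists because a strategy can be prolonged by doing nothing,
so the infimum is antitone (`antitone_infExpectedCost`). -/

/-! ### Processes at independent random times, and expectations. -/

/-- The process is a pointwise limit of its values at grid times strictly to the right of `t`. The
σ-algebra is arbitrary so that it can be the one generated by the price path alone. -/
lemma measurable_eval_of_rightContinuous {Ω : Type*} [MeasurableSpace Ω] {X : ℝ≥0 → Ω → ℝ}
    (hX : ∀ t, Measurable (X t))
    (hrc : ∀ ω t, ContinuousWithinAt (fun s => X s ω) (Set.Ioi t) t) :
    Measurable (fun p : Ω × ℝ≥0 => X p.2 p.1) := by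
  obtain ⟨g, hg⟩ : ∃ g : ℕ → ℕ → ℝ≥0, ∀ n k, g n k = ((k : ℝ≥0) + 1) / (n + 1) :=
    ⟨_, fun _ _ => rfl⟩
  let r : ℕ → ℝ≥0 → ℝ≥0 := fun n t => g n ⌊t * (n + 1)⌋₊
  have hr_lt : ∀ n t, t < r n t := by
    intro n t
    simp only [r, hg]
    rw [lt_div_iff₀ (by positivity)]
    exact Nat.lt_floor_add_one _
  have hr_le : ∀ n t, r n t ≤ t + 1 / (n + 1) := by
    intro n t
    simp only [r, hg]
    rw [div_le_iff₀ (by positivity), add_mul, div_mul_cancel₀ _ (by positivity)]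
    gcongr
    exact Nat.floor_le (by positivity)
  have hr_tendsto : ∀ t, Tendsto (fun n => r n t) atTop (𝓝[>] t) := by
    intro t
    refine tendsto_nhdsWithin_iff.2 ⟨?_, Eventually.of_forall fun n => hr_lt n t⟩
    refine tendsto_of_tendsto_of_tendsto_of_le_of_le tendsto_const_nhds ?_
      (fun n => (hr_lt n t).le) (fun n => hr_le n t)
    have : Tendsto (fun n : ℕ => t + 1 / ((n : ℝ≥0) + 1)) atTop (𝓝 (t + 0)) :=
      tendsto_const_nhds.add tendsto_one_div_add_atTop_nhds_zero_nat
    simpa using this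
  refine measurable_of_tendsto_metrizable (f := fun n p => X (r n p.2) p.1) (fun n => ?_) ?_
  · have h1 : Measurable fun q : Ω × ℕ => X (g n q.2) q.1 :=
      measurable_from_prod_countable_left fun k => hX (g n k)
    have h2 : Measurable fun p : Ω × ℝ≥0 => (p.1, ⌊p.2 * ((n : ℝ≥0) + 1)⌋₊) :=
      measurable_fst.prodMk (Nat.measurable_floor.comp (measurable_snd.mul_const _))
    exact h1.comp h2
  · rw [tendsto_pi_nhds]
    intro p
    exact (hrc p.1 p.2).tendsto.comp (hr_tendsto p.2)

/-- A process evaluated at an independent random time and multiplied by an independent weight. -/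
lemma integral_mul_eval_of_indepFun {Ω Ω' : Type*} [MeasurableSpace Ω] [MeasurableSpace Ω']
    {μ : Measure Ω} [IsProbabilityMeasure μ] {U : Ω → Ω'} {X : ℝ≥0 → Ω' → ℝ} (hU : Measurable U)
    (hX : Measurable (fun p : Ω' × ℝ≥0 => X p.2 p.1)) {T : ℝ≥0} {p B : ℝ}
    (hint : ∀ t ≤ T, Integrable (fun ω => X t (U ω)) μ) (hp : ∀ t ≤ T, ∫ ω, X t (U ω) ∂μ = p)
    (hB : ∀ t ≤ T, ∫ ω, |X t (U ω)| ∂μ ≤ B) {W : Ω → ℝ} {τ : Ω → ℝ≥0} (hW : Measurable W)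
    (hτ : Measurable τ) (hτT : ∀ ω, τ ω ≤ T) (hWi : Integrable W μ)
    (hind : IndepFun U (fun ω => (W ω, τ ω)) μ) :
    Integrable (fun ω => W ω * X (τ ω) (U ω)) μ ∧
      ∫ ω, W ω * X (τ ω) (U ω) ∂μ = p * ∫ ω, W ω ∂μ ∧
      ∫ ω, |W ω * X (τ ω) (U ω)| ∂μ ≤ B * ∫ ω, |W ω| ∂μ := by
  have hV : Measurable fun ω => (W ω, τ ω) := hW.prodMk hτ
  have hXm : ∀ t, Measurable (X t) := fun t => hX.comp (measurable_id.prodMk measurable_const)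
  -- By independence the joint law is a product, so Fubini allows freezing the weight and the time
  -- and integrating over the path first.
  let κ : Measure (Ω' × ℝ × ℝ≥0) := (μ.map U).prod (μ.map fun ω => (W ω, τ ω))
  have hmap : μ.map (fun ω => (U ω, W ω, τ ω)) = κ :=
    (indepFun_iff_map_prod_eq_prod_map_map hU.aemeasurable hV.aemeasurable).1 hind
  have : IsProbabilityMeasure (μ.map U) := Measure.isProbabilityMeasure_map hU.aemeasurable
  have : IsProbabilityMeasure (μ.map fun ω => (W ω, τ ω)) :=
    Measure.isProbabilityMeasure_map hV.aemeasurable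
  let f : Ω' × ℝ × ℝ≥0 → ℝ := fun q => q.2.1 * X q.2.2 q.1
  have hf : Measurable f := (measurable_fst.comp measurable_snd).mul
    (hX.comp (measurable_fst.prodMk (measurable_snd.comp measurable_snd)))
  have hpair : Measurable fun ω => (U ω, W ω, τ ω) := hU.prodMk hV
  have hle : ∀ᵐ v ∂μ.map fun ω => (W ω, τ ω), v.2 ≤ T :=
    (ae_map_iff hV.aemeasurable (measurableSet_le measurable_snd measurable_const)).2
      (Eventually.of_forall hτT)
  have hnorm : ∀ t, ∫ u, ‖X t u‖ ∂μ.map U = ∫ ω, |X t (U ω)| ∂μ := fun t =>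
    integral_map hU.aemeasurable (hXm t).norm.aestronglyMeasurable
  have hfst : Integrable (fun v : ℝ × ℝ≥0 => v.1) (μ.map fun ω => (W ω, τ ω)) :=
    (integrable_map_measure measurable_fst.aestronglyMeasurable hV.aemeasurable).2 hWi
  have hbd : ∀ᵐ v ∂μ.map fun ω => (W ω, τ ω), ∫ u, ‖f (u, v)‖ ∂μ.map U ≤ B * |v.1| := by
    filter_upwards [hle] with v hv
    simp only [f, norm_mul, integral_const_mul, hnorm, Real.norm_eq_abs v.1]
    rw [mul_comm]
    exact mul_le_mul_of_nonneg_right (hB _ hv) (abs_nonneg _)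
  have hfi : Integrable f κ := by
    rw [integrable_prod_iff' hf.aestronglyMeasurable]
    constructor
    · filter_upwards [hle] with v hv
      exact ((integrable_map_measure (hXm _).aestronglyMeasurable hU.aemeasurable).2
        (hint _ hv)).const_mul v.1
    · refine Integrable.mono' (hfst.abs.const_mul B)
        hf.norm.stronglyMeasurable.integral_prod_left'.aestronglyMeasurable ?_
      filter_upwards [hbd] with v hv
      rwa [Real.norm_of_nonneg (integral_nonneg fun _ => norm_nonneg _)]
  refine ⟨?_, ?_, ?_⟩
  · rw [← hmap] at hfi
    exact hfi.comp_measurable hpair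
  · calc ∫ ω, W ω * X (τ ω) (U ω) ∂μ = ∫ q, f q ∂κ := by
          rw [← hmap, integral_map hpair.aemeasurable hf.aestronglyMeasurable]
      _ = ∫ v, ∫ u, f (u, v) ∂μ.map U ∂μ.map fun ω => (W ω, τ ω) := integral_prod_symm _ hfi
      _ = ∫ v, p * v.1 ∂μ.map fun ω => (W ω, τ ω) := by
          refine integral_congr_ae ?_
          filter_upwards [hle] with v hv
          simp only [f, integral_const_mul]
          rw [integral_map hU.aemeasurable (hXm _).aestronglyMeasurable, hp _ hv, mul_comm]
      _ = p * ∫ ω, W ω ∂μ := by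
          rw [integral_const_mul, integral_map hV.aemeasurable
            measurable_fst.aestronglyMeasurable]
  · calc ∫ ω, |W ω * X (τ ω) (U ω)| ∂μ = ∫ q, ‖f q‖ ∂κ := by
          rw [← hmap, integral_map hpair.aemeasurable hf.norm.aestronglyMeasurable]
          rfl
      _ = ∫ v, ∫ u, ‖f (u, v)‖ ∂μ.map U ∂μ.map fun ω => (W ω, τ ω) :=
          integral_prod_symm _ hfi.norm
      _ ≤ ∫ v, B * |v.1| ∂μ.map fun ω => (W ω, τ ω) :=
          integral_mono_ae hfi.norm.integral_prod_right (hfst.abs.const_mul B) hbd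
      _ = B * ∫ ω, |W ω| ∂μ := by
          rw [integral_const_mul, integral_map hV.aemeasurable
            measurable_fst.abs.aestronglyMeasurable]

lemma expectation_congr {Ω : Type*} [MeasurableSpace Ω] {μ : Measure Ω} {C D : Ω → EReal}
    (h : C =ᵐ[μ] D) : expectation μ C = expectation μ D := by
  have h1 : ∫⁻ ω, (C ω).toENNReal ∂μ = ∫⁻ ω, (D ω).toENNReal ∂μ :=
    lintegral_congr_ae (by filter_upwards [h] with ω hω using by rw [hω])
  have h2 : ∫⁻ ω, (-C ω).toENNReal ∂μ = ∫⁻ ω, (-D ω).toENNReal ∂μ :=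
    lintegral_congr_ae (by filter_upwards [h] with ω hω using by rw [hω])
  simp only [expectation, h1, h2]

lemma expectation_coe {Ω : Type*} [MeasurableSpace Ω] {μ : Measure Ω} {f : Ω → ℝ}
    (hf : Integrable f μ) : expectation μ (fun ω => (f ω : EReal)) = ((∫ ω, f ω ∂μ : ℝ) : EReal) := by
  have h1 : ∫⁻ ω, ENNReal.ofReal (f ω) ∂μ ≠ ⊤ := hf.lintegral_lt_top.ne
  have h2 : ∫⁻ ω, ENNReal.ofReal (-f ω) ∂μ ≠ ⊤ := hf.neg.lintegral_lt_top.ne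
  have e1 : ∀ ω, (f ω : EReal).toENNReal = ENNReal.ofReal (f ω) := fun ω => by
    simp [EReal.toENNReal]
  have e2 : ∀ ω, (-(f ω : EReal)).toENNReal = ENNReal.ofReal (-f ω) := fun ω => by
    rw [← EReal.coe_neg]
    simp [EReal.toENNReal]
  simp only [expectation, e1, e2, h1, h2, false_and, if_false]
  rw [integral_eq_lintegral_pos_part_sub_lintegral_neg_part hf, EReal.coe_sub,
    EReal.coe_ennreal_toReal h1, EReal.coe_ennreal_toReal h2]

/-! ### All-or-nothing dark-pool orders. -/

lemma fill_zero_of_full (x : ℝ) (y : ℝ≥0∞) :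
    fill x |x| 0 y = if ENNReal.ofReal |x| ≤ y then x else 0 := by
  unfold fill
  split_ifs with h1 h2
  -- A matching order that is large enough and yet fits must have size exactly `|x|`.
  · have : y = ENNReal.ofReal |x| := le_antisymm (by simpa using h2) h1
    rw [this, ENNReal.toReal_ofReal (abs_nonneg x), sign_mul_abs]
  · simp
  · rfl

lemma fill_self_of_full {x : ℝ} (hx : x ≠ 0) (y : ℝ≥0∞) : fill x |x| x y = 0 := by
  unfold fill
  split_ifs with h1 h2
  · exfalso
    have h0 : 0 < ENNReal.ofReal |x| := ENNReal.ofReal_pos.2 (abs_pos.2 hx)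
    have h3 := (add_le_add_right h1 (ENNReal.ofReal |x|)).trans h2
    exact (ENNReal.lt_add_right ENNReal.ofReal_ne_top h0.ne').not_ge h3
  · simp
  · rfl

/-- An order with minimum quantity equal to its size is either filled completely or not at all. -/
lemma filled_of_full {x : ℝ} (hx : x ≠ 0) (y : ℕ → ℝ≥0∞) (k : ℕ) :
    filled x |x| y k = if ∃ j < k, ENNReal.ofReal |x| ≤ y j then x else 0 := by
  induction k with
  | zero => simp [filled]
  | succ k ih =>
    rw [filled, ih]
    by_cases h : ∃ j < k, ENNReal.ofReal |x| ≤ y j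
    · have h' : ∃ j < k + 1, ENNReal.ofReal |x| ≤ y j :=
        h.imp fun j hj => ⟨hj.1.trans (Nat.lt_succ_self k), hj.2⟩
      rw [if_pos h, if_pos h', fill_self_of_full hx, add_zero]
    · rw [if_neg h, fill_zero_of_full, zero_add]
      refine if_congr ⟨fun hk => ⟨k, Nat.lt_succ_self k, hk⟩, ?_⟩ rfl rfl
      rintro ⟨j, hj, hjy⟩
      rcases Nat.lt_succ_iff_lt_or_eq.1 hj with hj | rfl
      · exact absurd ⟨j, hj, hjy⟩ h
      · exact hjy

lemma measurable_sum_range {Ω : Type*} [MeasurableSpace Ω] {n : Ω → ℕ} {f : ℕ → Ω → ℝ}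
    (hn : Measurable n) (hf : ∀ i, Measurable (f i)) :
    Measurable fun ω => ∑ i ∈ Finset.range (n ω), f i ω := by
  have h1 : Measurable fun p : Ω × ℕ => ∑ i ∈ Finset.range p.2, f i p.1 :=
    measurable_from_prod_countable_left fun n =>
      Finset.measurable_fun_sum (Finset.range n) fun i _ => hf i
  exact h1.comp (measurable_id.prodMk hn)

namespace Model

variable {Ω : Type*} [mΩ : MeasurableSpace Ω] {μ : Measure Ω} (M : Model μ)

lemma filled_eq_sum_Y (x Xi : ℝ) (ω : Ω) (k : ℕ) :
    filled x Xi (fun j => M.Ytilde j ω) k = ∑ i ∈ Finset.range k, M.Y x Xi i ω := by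
  induction k with
  | zero => rfl
  | succ k ih => rw [Finset.sum_range_succ, ← ih, filled, Y]

lemma Z_of_full {x : ℝ} (hx : x ≠ 0) (t : ℝ≥0) (ω : Ω) :
    M.Z x |x| t ω = if ∃ j < M.N t ω, ENNReal.ofReal |x| ≤ M.Ytilde j ω then x else 0 := by
  rw [Z, ← filled_eq_sum_Y, filled_of_full hx]

lemma abs_Z_le {x : ℝ} (hx : x ≠ 0) (t : ℝ≥0) (ω : Ω) : |M.Z x |x| t ω| ≤ |x| := by
  rw [M.Z_of_full hx]
  split_ifs <;> simp

/-- At most one execution is nonzero. The bound is uniform in the number of arrivals, which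
justifies exchanging expectation and random sum later. -/
lemma sum_abs_Y_le {x : ℝ} (hx : x ≠ 0) (k : ℕ) (ω : Ω) :
    ∑ i ∈ Finset.range k, |M.Y x |x| i ω| ≤ |x| := by
  have h0 : ∀ k, filled x |x| (fun j => M.Ytilde j ω) k = 0 ∨
      filled x |x| (fun j => M.Ytilde j ω) k = x := fun k => by
    rw [filled_of_full hx]
    split_ifs <;> simp
  have h : ∀ k, ∑ i ∈ Finset.range k, |M.Y x |x| i ω|
      = |filled x |x| (fun j => M.Ytilde j ω) k| := fun k => by
    induction k with
    | zero => simp [filled]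
    | succ k ih =>
      rw [Finset.sum_range_succ, ih, filled, Y]
      rcases h0 k with h | h
      · rw [h, abs_zero, zero_add, zero_add]
      · rw [h, fill_self_of_full hx, abs_zero, add_zero, add_zero]
  rw [h]
  rcases h0 k with h | h <;> simp [h]

/-! ### Order flow, its independence of the price, and predictability. -/

lemma lt_N_iff (t : ℝ≥0) (ω : Ω) (n : ℕ) : n < M.N t ω ↔ M.τ n ω ≤ t := by
  rw [← not_le, M.N_le_iff, not_lt]

/-- The information contained in the arrival times and the sizes of the matching orders. -/
@[reducible]
noncomputable def orderFlow : MeasurableSpace Ω :=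
  MeasurableSpace.comap (fun ω t => M.N t ω) inferInstance ⊔
    MeasurableSpace.comap (fun ω i => M.Ytilde i ω) inferInstance

lemma orderFlow_le : M.orderFlow ≤ mΩ :=
  sup_le (measurable_pi_lambda _ M.measurable_N).comap_le
    (measurable_pi_lambda _ M.measurable_Ytilde).comap_le

lemma measurable_N_orderFlow (t : ℝ≥0) : Measurable[M.orderFlow] (M.N t) := by
  have h : Measurable[MeasurableSpace.comap (fun ω t => M.N t ω) inferInstance]
      (fun ω t => M.N t ω) := comap_measurable _
  exact ((measurable_pi_apply t).comp h).mono le_sup_left le_rfl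

/-- Independence is assumed for the counting process; the arrival times are recovered from it. -/
lemma measurable_τ_orderFlow (i : ℕ) : Measurable[M.orderFlow] (M.τ i) := by
  refine @measurable_of_Ioi _ _ _ _ _ M.orderFlow _ _ _ _ fun t => ?_
  have : M.τ i ⁻¹' Set.Ioi t = M.N t ⁻¹' Set.Iic i := by
    ext ω
    exact (M.N_le_iff t ω i).symm
  rw [this]
  exact M.measurable_N_orderFlow t measurableSet_Iic

lemma measurable_Y_orderFlow (x Xi : ℝ) (i : ℕ) : Measurable[M.orderFlow] (M.Y x Xi i) := by
  have h : Measurable[M.orderFlow] (fun ω j => M.Ytilde j ω) :=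
    (comap_measurable _).mono le_sup_right le_rfl
  exact (measurable_fill x Xi).comp
    (((measurable_filled x Xi i).comp h).prodMk ((measurable_pi_apply i).comp h))

lemma measurable_Z_orderFlow (x Xi : ℝ) (t : ℝ≥0) : Measurable[M.orderFlow] (M.Z x Xi t) :=
  @measurable_sum_range Ω M.orderFlow _ _ (M.measurable_N_orderFlow t)
    (M.measurable_Y_orderFlow x Xi)

variable {M} in
lemma PoissonArrivals.indep_orderFlow {θ : ℝ≥0} {ν : Measure ℝ≥0∞} [IsProbabilityMeasure μ]
    (hM : M.PoissonArrivals θ ν) :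
    Indep (MeasurableSpace.comap (fun ω t => M.P0 t ω) inferInstance) M.orderFlow μ := by
  have hP : ∀ t, Measurable (M.P0 t) := fun t =>
    ((M.martingale.1 t).mono (M.F.le t)).measurable
  have h := indep_iSup_of_disjoint (S := {0}) (T := {1, 2}) (fun i => ?_) hM.indep (by simp)
  · simpa [iSup_or, iSup_sup_eq] using h
  · fin_cases i
    · exact (measurable_pi_lambda _ hP).comap_le
    · exact (measurable_pi_lambda _ M.measurable_N).comap_le
    · exact (measurable_pi_lambda _ M.measurable_Ytilde).comap_le

lemma measurable_Z_G (x Xi : ℝ) (t : ℝ≥0) : Measurable[M.G x Xi t] (M.Z x Xi t) := by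
  have h1 : Measurable[Filtration.natural (M.Z x Xi)
      (fun t => (M.measurable_Z x Xi t).stronglyMeasurable) t] (M.Z x Xi t) :=
    (Filtration.stronglyAdapted_natural
      (fun t => (M.measurable_Z x Xi t).stronglyMeasurable) t).measurable
  exact h1.mono ((le_sup_right.trans le_sup_left : _ ≤ M.F ⊔ Filtration.natural (M.Z x Xi) _ ⊔
    _).trans (Filtration.le_rightCont _) t) le_rfl

lemma measurable_min_τ_G (x Xi : ℝ) (i : ℕ) (t : ℝ≥0) :
    Measurable[M.G x Xi t] (fun ω => min (M.τ i ω) t) := by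
  have h1 : Measurable[Filtration.natural (fun t ω => min (M.τ i ω) t)
      (fun _ => ((M.measurable_τ i).min measurable_const).stronglyMeasurable) t]
      (fun ω => min (M.τ i ω) t) :=
    (Filtration.stronglyAdapted_natural
      (fun _ => ((M.measurable_τ i).min measurable_const).stronglyMeasurable) t).measurable
  refine h1.mono (le_trans ?_ (Filtration.le_rightCont _ t)) le_rfl
  have h2 : Filtration.natural (fun t ω => min (M.τ i ω) t)
      (fun _ => ((M.measurable_τ i).min measurable_const).stronglyMeasurable) ≤
      ⨆ i : ℕ, Filtration.natural (fun t ω => min (M.τ i ω) t)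
      (fun _ => ((M.measurable_τ i).min measurable_const).stronglyMeasurable) :=
    le_iSup (fun i : ℕ => Filtration.natural (fun t ω => min (M.τ i ω) t)
      (fun _ => ((M.measurable_τ i).min measurable_const).stronglyMeasurable)) i
  exact (h2.trans le_sup_right) t

/-- The complement is a countable union of rectangles `(q, ∞) × {τ i < q}`, each with its event
known at time `q`. -/
lemma measurableSet_predictable_le_τ (x Xi : ℝ) (i : ℕ) :
    MeasurableSet[(M.G x Xi).predictable] {p : ℝ≥0 × Ω | p.1 ≤ M.τ i p.2} := by
  obtain ⟨D, hDc, hDd⟩ := TopologicalSpace.exists_countable_dense ℝ≥0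
  have : {p : ℝ≥0 × Ω | p.1 ≤ M.τ i p.2}
      = (⋃ q ∈ D, Set.Ioi q ×ˢ {ω | min (M.τ i ω) q < q})ᶜ := by
    ext ⟨t, ω⟩
    simp only [Set.mem_ofPred_eq, Set.mem_compl_iff, Set.mem_iUnion, Set.mem_prod, Set.mem_Ioi,
      min_lt_iff, lt_irrefl, or_false, exists_prop, not_exists, not_and]
    constructor
    · exact fun h q _ hqt hq => (hq.trans hqt).not_ge h
    · intro h
      by_contra! hlt
      obtain ⟨q, hq, h1, h2⟩ := hDd.exists_between hlt
      exact h q hq h2 h1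
  rw [this]
  refine (MeasurableSet.biUnion hDc fun q _ => measurableSet_predictable_Ioi_prod ?_).compl
  exact M.measurable_min_τ_G x Xi i q measurableSet_Iio

lemma measurableSet_predictable_Ioi (𝓖 : Filtration ℝ≥0 mΩ) (t : ℝ≥0) :
    MeasurableSet[𝓖.predictable] {p : ℝ≥0 × Ω | t < p.1} := by
  have : {p : ℝ≥0 × Ω | t < p.1} = Set.Ioi t ×ˢ Set.univ := by ext; simp
  rw [this]
  exact measurableSet_predictable_Ioi_prod MeasurableSet.univ

/-- This covers the final liquidation, whose speed is fixed by information at time `S` and used only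
after `S`. -/
lemma measurable_predictable_indicator_Ioi (𝓖 : Filtration ℝ≥0 mΩ) (t : ℝ≥0) {D : Ω → ℝ}
    (hD : Measurable[𝓖 t] D) :
    Measurable[𝓖.predictable] ({p : ℝ≥0 × Ω | t < p.1}.indicator fun p => D p.2) := by
  intro s hs
  have h1 : MeasurableSet[𝓖.predictable] (Set.Ioi t ×ˢ (D ⁻¹' s)) :=
    measurableSet_predictable_Ioi_prod (hD hs)
  by_cases h0 : (0 : ℝ) ∈ s
  · convert h1.union (measurableSet_predictable_Ioi 𝓖 t).compl using 1
    ext ⟨u, ω⟩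
    by_cases hu : t < u <;> simp [Set.indicator, hu, h0, -not_lt]
  · convert h1 using 1
    ext ⟨u, ω⟩
    by_cases hu : t < u <;> simp [Set.indicator, hu, h0]

/-! ### The manipulation strategy. -/

/-- The strategy that trades at the constant speed `c` until the first arrival, keeps a dark-pool
order of size `x` until time `S`, and liquidates the remaining position at constant speed during
`(S, T]`. -/
noncomputable def buildUp (X₀ x c : ℝ) (S T : ℝ≥0) : Strategy Ω where
  Xhat := x
  Xi := |x|
  ξ t ω := if t ≤ S then (if t ≤ M.τ 0 ω then c else 0)
    else -(X₀ + M.Z x |x| S ω + c * min (M.τ 0 ω) S) / (T - S)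
  ρ _ := S

lemma isStronglyPredictable_buildUp (X₀ x c : ℝ) (S T : ℝ≥0) :
    IsStronglyPredictable (M.G x |x|) (M.buildUp X₀ x c S T).ξ := by
  have h1 : Measurable[(M.G x |x|).predictable]
      ({p : ℝ≥0 × Ω | S < p.1}.indicator fun p =>
        -(X₀ + M.Z x |x| S p.2 + c * min (M.τ 0 p.2) S) / (T - S)) := by
    refine measurable_predictable_indicator_Ioi (M.G x |x|) S
      (D := fun ω => -(X₀ + M.Z x |x| S ω + c * min (M.τ 0 ω) S) / (T - S)) ?_
    have h2 := M.measurable_Z_G x |x| S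
    have h3 : Measurable[M.G x |x| S] fun ω => (min (M.τ 0 ω : ℝ) S) := by
      have := measurable_coe_nnreal_real.comp (M.measurable_min_τ_G x |x| 0 S)
      simpa only [Function.comp_def, NNReal.coe_min] using this
    exact (((measurable_const.add h2).add (h3.const_mul c)).neg).div_const _
  have h2 : Measurable[(M.G x |x|).predictable]
      (({p : ℝ≥0 × Ω | S < p.1}ᶜ ∩ {p : ℝ≥0 × Ω | p.1 ≤ M.τ 0 p.2}).indicator fun _ => c) :=
    measurable_const.indicator ((measurableSet_predictable_Ioi _ S).compl.inter
      (M.measurableSet_predictable_le_τ x |x| 0))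
  refine Measurable.stronglyMeasurable ?_
  convert h1.add h2 using 1
  ext ⟨t, ω⟩
  by_cases ht : t ≤ S <;> by_cases hτ : t ≤ M.τ 0 ω <;>
    simp [buildUp, Function.uncurry, Set.indicator, ht, hτ, not_lt.2, not_le.1]

end Model
-- Integrals along a piecewise constant trading speed.
/-- The integral of a function that is given by continuous functions on `(0, m]` and `(s, t]` and
vanishes on `(m, s]`. -/
lemma integral_of_piecewise {f g₁ g₂ : ℝ → ℝ} {m s t : ℝ} (h0m : 0 ≤ m) (hms : m ≤ s)
    (hst : s ≤ t) (hg₁ : Continuous g₁) (hg₂ : Continuous g₂)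
    (h1 : ∀ u, 0 < u → u ≤ m → f u = g₁ u) (h2 : ∀ u, m < u → u ≤ s → f u = 0)
    (h3 : ∀ u, s < u → u ≤ t → f u = g₂ u) :
    IntervalIntegrable f volume 0 t ∧
      ∫ u in (0 : ℝ)..t, f u = (∫ u in (0 : ℝ)..m, g₁ u) + ∫ u in s..t, g₂ u := by
  have e1 : Set.EqOn g₁ f (Set.uIoc 0 m) := fun u hu => by
    rw [Set.uIoc_of_le h0m] at hu
    exact (h1 u hu.1 hu.2).symm
  have e2 : Set.EqOn (fun _ => (0 : ℝ)) f (Set.uIoc m s) := fun u hu => by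
    rw [Set.uIoc_of_le hms] at hu
    exact (h2 u hu.1 hu.2).symm
  have e3 : Set.EqOn g₂ f (Set.uIoc s t) := fun u hu => by
    rw [Set.uIoc_of_le hst] at hu
    exact (h3 u hu.1 hu.2).symm
  have i1 : IntervalIntegrable f volume 0 m := (hg₁.intervalIntegrable 0 m).congr e1
  have i2 : IntervalIntegrable f volume m s :=
    (intervalIntegrable_const (c := (0 : ℝ))).congr e2
  have i3 : IntervalIntegrable f volume s t := (hg₂.intervalIntegrable s t).congr e3
  refine ⟨(i1.trans i2).trans i3, ?_⟩
  rw [← intervalIntegral.integral_add_adjacent_intervals (i1.trans i2) i3,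
    ← intervalIntegral.integral_add_adjacent_intervals i1 i2,
    ← intervalIntegral.integral_congr_ae (Eventually.of_forall e1),
    ← intervalIntegral.integral_congr_ae (Eventually.of_forall e2),
    ← intervalIntegral.integral_congr_ae (Eventually.of_forall e3)]
  simp

/-- Constant speed `c` until time `a ∧ s`, and constant speed `d` after time `s`. -/
noncomputable def twoPhase (c d : ℝ) (a s : ℝ≥0) (t : ℝ≥0) : ℝ :=
  if t ≤ s then (if t ≤ a then c else 0) else d

section twoPhase

variable (c d : ℝ) (a s : ℝ≥0)

lemma timeIntegral_twoPhase {t : ℝ≥0} (hst : s ≤ t) :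
    TimeIntegrable (twoPhase c d a s) t ∧
      timeIntegral (twoPhase c d a s) t = c * min (a : ℝ) s + d * (t - s) := by
  have h := integral_of_piecewise (f := fun u : ℝ => twoPhase c d a s u.toNNReal)
    (g₁ := fun _ => c) (g₂ := fun _ => d) (m := min (a : ℝ) s) (s := s) (t := t)
    (by positivity) (min_le_right _ _) hst continuous_const continuous_const
    (fun u hu hum => ?_) (fun u hu hus => ?_) (fun u hu _ => ?_)
  · refine ⟨h.1, h.2.trans ?_⟩
    simp
    ring
  · rw [le_min_iff] at hum
    simp [twoPhase, Real.toNNReal_le_iff_le_coe, hum.1, hum.2]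
  · have : ¬ u ≤ a := fun hua => hu.not_ge (le_min hua hus)
    simp [twoPhase, Real.toNNReal_le_iff_le_coe, hus, this]
  · simp [twoPhase, Real.toNNReal_le_iff_le_coe, hu.not_ge]

lemma timeIntegral_twoPhase_of_le {t : ℝ≥0} (hts : t ≤ s) :
    timeIntegral (twoPhase c d a s) t = c * min (a : ℝ) t := by
  have h := (timeIntegral_twoPhase c d a t le_rfl).2
  -- Up to time `t ≤ s` the path agrees with the one whose switching time is `t` itself.
  rw [sub_self, mul_zero, add_zero] at h
  rw [← h]
  refine intervalIntegral.integral_congr_ae (Eventually.of_forall fun u hu => ?_)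
  rw [Set.uIoc_of_le t.coe_nonneg] at hu
  have h1 : u.toNNReal ≤ t := Real.toNNReal_le_iff_le_coe.2 hu.2
  simp only [twoPhase, h1, h1.trans hts, if_true]

/-- With `X` the cumulative trade, `γ X X'` integrates to `γ/2 X²`, so permanent impact depends only
on the total traded. -/
lemma timeIntegral_twoPhase_impact (γ η : ℝ) {t : ℝ≥0} (hst : s ≤ t) :
    TimeIntegrable (fun u => twoPhase c d a s u *
        (γ * timeIntegral (twoPhase c d a s) u + η * twoPhase c d a s u)) t ∧
      timeIntegral (fun u => twoPhase c d a s u *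
        (γ * timeIntegral (twoPhase c d a s) u + η * twoPhase c d a s u)) t
      = γ / 2 * (c * min (a : ℝ) s + d * (t - s)) ^ 2
        + η * (c ^ 2 * min (a : ℝ) s + d ^ 2 * (t - s)) := by
  have h := integral_of_piecewise
    (f := fun u : ℝ => twoPhase c d a s u.toNNReal *
        (γ * timeIntegral (twoPhase c d a s) u.toNNReal + η * twoPhase c d a s u.toNNReal))
    (g₁ := fun u => c * γ * c * u + η * c ^ 2)
    -- After `s` the cumulative trade is `c * min a s + d * (u - s)`; `g₂` is the integrand expanded
    -- as an affine function of `u`.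
    (g₂ := fun u => d * γ * d * u + (d * γ * (c * min (a : ℝ) s - d * s) + η * d ^ 2))
    (m := min (a : ℝ) s) (s := s) (t := t)
    (by positivity) (min_le_right _ _) hst (by fun_prop) (by fun_prop)
    (fun u hu hum => ?_) (fun u hu hus => ?_) (fun u hu _ => ?_)
  · refine ⟨h.1, h.2.trans ?_⟩
    have haff : ∀ p q u v : ℝ, ∫ r in u..v, (p * r + q) = p * ((v ^ 2 - u ^ 2) / 2) + (v - u) * q :=
      fun p q u v => by
        rw [intervalIntegral.integral_add (Continuous.intervalIntegrable (by fun_prop) _ _)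
          intervalIntegrable_const, intervalIntegral.integral_const_mul, integral_id,
          intervalIntegral.integral_const, smul_eq_mul]
    rw [haff, haff]
    ring
  · rw [le_min_iff] at hum
    have h1 : u.toNNReal ≤ s := Real.toNNReal_le_iff_le_coe.2 hum.2
    rw [timeIntegral_twoPhase_of_le c d a s h1, Real.coe_toNNReal u hu.le, min_eq_right hum.1]
    simp [twoPhase, Real.toNNReal_le_iff_le_coe, hum.1, hum.2]
    ring
  · have : ¬ u ≤ a := fun hua => hu.not_ge (le_min hua hus)
    simp [twoPhase, Real.toNNReal_le_iff_le_coe, hus, this]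
  · have h0 : 0 ≤ u := s.2.trans hu.le
    have h1 : s ≤ u.toNNReal := (Real.le_toNNReal_iff_coe_le h0).2 hu.le
    rw [(timeIntegral_twoPhase c d a s h1).2, Real.coe_toNNReal u h0]
    simp [twoPhase, Real.toNNReal_le_iff_le_coe, hu.not_ge]
    ring

end twoPhase

/-! ### Admissibility of the manipulation strategy. -/

namespace Model

variable {Ω : Type*} [mΩ : MeasurableSpace Ω] {μ : Measure Ω} (M : Model μ)

/-- The speed of the final liquidation of `buildUp`. -/
noncomputable def exitSpeed (X₀ x c : ℝ) (S T : ℝ≥0) (ω : Ω) : ℝ :=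
  -(X₀ + M.Z x |x| S ω + c * min (M.τ 0 ω) S) / (T - S)

lemma buildUp_ξ (X₀ x c : ℝ) (S T : ℝ≥0) (ω : Ω) :
    (fun t => (M.buildUp X₀ x c S T).ξ t ω) = twoPhase c (M.exitSpeed X₀ x c S T ω) (M.τ 0 ω) S :=
  rfl

lemma exitSpeed_mul {S T : ℝ≥0} (hST : S < T) (X₀ x c : ℝ) (ω : Ω) :
    M.exitSpeed X₀ x c S T ω * (T - S) = -(X₀ + M.Z x |x| S ω + c * min (M.τ 0 ω : ℝ) S) := by
  have : (0 : ℝ) < T - S := sub_pos.2 hST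
  rw [exitSpeed, div_mul_cancel₀ _ this.ne', NNReal.coe_min]

lemma abs_exitPosition_le {x : ℝ} (hx : x ≠ 0) (X₀ c : ℝ) (S : ℝ≥0) (ω : Ω) :
    |X₀ + M.Z x |x| S ω + c * min (M.τ 0 ω : ℝ) S| ≤ |X₀| + |x| + |c| * S := by
  refine (abs_add_le _ _).trans (add_le_add ((abs_add_le _ _).trans ?_) ?_)
  · exact add_le_add le_rfl (M.abs_Z_le hx S ω)
  · rw [abs_mul, abs_of_nonneg (by positivity : (0 : ℝ) ≤ min (M.τ 0 ω : ℝ) S)]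
    gcongr
    exact min_le_right _ _

lemma isAdmissible_buildUp {x : ℝ} (hx : x ≠ 0) (X₀ c : ℝ) {S T : ℝ≥0} (hST : S < T) :
    M.IsAdmissible X₀ T (M.buildUp X₀ x c S T) where
  Xi_mem := ⟨abs_nonneg x, le_rfl⟩
  stopping := isStoppingTime_const _ S
  lt_horizon := Eventually.of_forall fun _ => hST
  predictable := M.isStronglyPredictable_buildUp X₀ x c S T
  integrable := Eventually.of_forall fun _ => (timeIntegral_twoPhase _ _ _ _ hST.le).1
  bounded := by
    refine ⟨|c| * S + (|X₀| + |x| + |c| * S), Eventually.of_forall fun ω t htT => ?_⟩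
    rw [buildUp_ξ]
    have hm : ∀ r : ℝ≥0, r ≤ S → |c * min (M.τ 0 ω : ℝ) r| ≤ |c| * S := fun r hr => by
      rw [abs_mul, abs_of_nonneg (by positivity : (0 : ℝ) ≤ min (M.τ 0 ω : ℝ) r)]
      gcongr
      exact (min_le_right _ _).trans hr
    rcases le_total t S with hts | hst
    · rw [timeIntegral_twoPhase_of_le _ _ _ _ hts]
      exact (hm t hts).trans (le_add_of_nonneg_right (by positivity))
    · rw [(timeIntegral_twoPhase _ _ _ _ hst).2]
      refine (abs_add_le _ _).trans (add_le_add (hm S le_rfl) ?_)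
      refine le_trans ?_ (M.abs_exitPosition_le hx X₀ c S ω)
      rw [← abs_neg (X₀ + _ + _), ← M.exitSpeed_mul hST, abs_mul, abs_mul]
      refine mul_le_mul_of_nonneg_left ?_ (abs_nonneg _)
      refine abs_le_abs_of_nonneg (sub_nonneg.2 hst) ?_
      have : (t : ℝ) ≤ T := htT
      linarith
  liquidation := Eventually.of_forall fun ω => by
    rw [buildUp_ξ, (timeIntegral_twoPhase _ _ _ _ hST.le).2, M.exitSpeed_mul hST]
    simp only [buildUp]
    ring

end Model
-- Expected contributions of the unaffected price.
lemma integrable_tsum_of_summable_integral_norm {Ω : Type*} [MeasurableSpace Ω] {μ : Measure Ω}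
    {F : ℕ → Ω → ℝ} (hF : ∀ i, Integrable (F i) μ) (hs : Summable fun i => ∫ ω, ‖F i ω‖ ∂μ)
    (hm : AEStronglyMeasurable (fun ω => ∑' i, F i ω) μ) :
    Integrable (fun ω => ∑' i, F i ω) μ := by
  refine ⟨hm, ?_⟩
  calc ∫⁻ ω, ‖∑' i, F i ω‖ₑ ∂μ ≤ ∫⁻ ω, ∑' i, ‖F i ω‖ₑ ∂μ :=
        lintegral_mono fun ω => enorm_tsum_le_tsum_enorm
    _ = ∑' i, ∫⁻ ω, ‖F i ω‖ₑ ∂μ := lintegral_tsum fun i => (hF i).1.enorm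
    _ = ∑' i, ENNReal.ofReal (∫ ω, ‖F i ω‖ ∂μ) := by
        congr 1 with i
        rw [ofReal_integral_norm_eq_lintegral_enorm (hF i)]
    _ < ⊤ := by
        rw [← ENNReal.ofReal_tsum_of_nonneg (fun i => integral_nonneg fun _ => norm_nonneg _) hs]
        exact ENNReal.ofReal_lt_top

namespace Model

variable {Ω : Type*} [mΩ : MeasurableSpace Ω] {μ : Measure Ω} {M : Model μ}

/-- The information contained in the path of the unaffected price. -/
@[reducible]
noncomputable def priceFlow (M : Model μ) : MeasurableSpace Ω :=
  MeasurableSpace.comap (fun ω t => M.P0 t ω) inferInstance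

lemma measurable_P0 (M : Model μ) (t : ℝ≥0) : Measurable (M.P0 t) :=
  ((M.martingale.1 t).mono (M.F.le t)).measurable

lemma measurable_P0_eval (M : Model μ) : Measurable (fun p : Ω × ℝ≥0 => M.P0 p.2 p.1) :=
  measurable_eval_of_rightContinuous M.measurable_P0 fun ω t => (M.cadlag ω t).1

lemma sum_range_N_eq_tsum (M : Model μ) (S : ℝ≥0) (ω : Ω) (y : ℕ → ℝ) :
    ∑ i ∈ Finset.range (M.N S ω), y i = ∑' i, if M.τ i ω ≤ S then y i else 0 := by
  rw [tsum_eq_sum (s := Finset.range (M.N S ω))]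
  · refine Finset.sum_congr rfl fun i hi => ?_
    rw [if_pos ((M.lt_N_iff S ω i).1 (Finset.mem_range.1 hi))]
  · intro i hi
    rw [if_neg fun h => hi (Finset.mem_range.2 ((M.lt_N_iff S ω i).2 h))]

variable [IsProbabilityMeasure μ]

lemma integral_P0 (M : Model μ) (t : ℝ≥0) : ∫ ω, M.P0 t ω ∂μ = ∫ ω, M.P0 0 ω ∂μ := by
  have h := M.martingale.setIntegral_eq (zero_le : 0 ≤ t) MeasurableSet.univ
  simpa using h.symm

/-- Conditional expectation contracts the `L¹` norm; this gives the uniform bound on a bounded time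
interval. -/
lemma integral_abs_P0_le {μ : Measure Ω} (M : Model μ) {t T : ℝ≥0} (h : t ≤ T) :
    ∫ ω, |M.P0 t ω| ∂μ ≤ ∫ ω, |M.P0 T ω| ∂μ := by
  refine le_trans (le_of_eq (integral_congr_ae ?_)) (integral_abs_condExp_le (m := M.F t) (M.P0 T))
  filter_upwards [M.martingale.condExp_ae_eq h] with ω hω
  rw [hω]

variable {θ : ℝ≥0} {ν : Measure ℝ≥0∞}

lemma PoissonArrivals.integral_mul_P0 (hM : M.PoissonArrivals θ ν) {T : ℝ≥0} {W : Ω → ℝ}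
    {σ : Ω → ℝ≥0} (hW : Measurable[M.orderFlow] W) (hσ : Measurable[M.orderFlow] σ)
    (hσT : ∀ ω, σ ω ≤ T) (hWi : Integrable W μ) :
    Integrable (fun ω => W ω * M.P0 (σ ω) ω) μ ∧
      ∫ ω, W ω * M.P0 (σ ω) ω ∂μ = (∫ ω, M.P0 0 ω ∂μ) * ∫ ω, W ω ∂μ ∧
      ∫ ω, |W ω * M.P0 (σ ω) ω| ∂μ ≤ (∫ ω, |M.P0 T ω| ∂μ) * ∫ ω, |W ω| ∂μ := by
  have hm : M.priceFlow ≤ mΩ := (measurable_pi_lambda _ M.measurable_P0).comap_le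
  have hP : ∀ t, Measurable[M.priceFlow] (M.P0 t) := fun t =>
    (measurable_pi_apply t).comp (comap_measurable (fun ω t => M.P0 t ω))
  have hi : @IndepFun Ω Ω (ℝ × ℝ≥0) mΩ M.priceFlow _ id (fun ω => (W ω, σ ω)) μ := by
    refine (@IndepFun_iff_Indep Ω Ω (ℝ × ℝ≥0) mΩ M.priceFlow _ id _ μ).2 ?_
    rw [MeasurableSpace.comap_id]
    exact indep_of_indep_of_le_right hM.indep_orderFlow (hW.prodMk hσ).comap_le
  exact @integral_mul_eval_of_indepFun Ω Ω mΩ M.priceFlow μ _ id M.P0 (fun s hs => hm s hs)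
    (@measurable_eval_of_rightContinuous Ω M.priceFlow M.P0 hP fun ω t => (M.cadlag ω t).1) T _ _
    (fun t _ => M.martingale.integrable t) (fun t _ => M.integral_P0 t)
    (fun t ht => M.integral_abs_P0_le ht) W σ (hW.mono M.orderFlow_le le_rfl)
    (hσ.mono M.orderFlow_le le_rfl) hσT hWi hi

/-- Each execution is a weight determined by the order flow times the price at an order-flow time,
so its mean factorises; summable `L¹` norms permit summation over arrivals. -/
lemma PoissonArrivals.integral_dark (hM : M.PoissonArrivals θ ν) {x : ℝ} (hx : x ≠ 0) (S : ℝ≥0) :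
    Integrable (fun ω => ∑ i ∈ Finset.range (M.N S ω), M.Y x |x| i ω * M.P0 (M.τ i ω) ω) μ ∧
      ∫ ω, ∑ i ∈ Finset.range (M.N S ω), M.Y x |x| i ω * M.P0 (M.τ i ω) ω ∂μ
        = (∫ ω, M.P0 0 ω ∂μ) * ∫ ω, M.Z x |x| S ω ∂μ := by
  let W : ℕ → Ω → ℝ := fun i ω => if M.τ i ω ≤ S then M.Y x |x| i ω else 0
  -- Capping the time at `S` changes nothing where `W i` is nonzero, and keeps the times bounded as
  -- `integral_mul_P0` requires.
  let F : ℕ → Ω → ℝ := fun i ω => W i ω * M.P0 (min (M.τ i ω) S) ω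
  have hτS : ∀ i, MeasurableSet[M.orderFlow] {ω | M.τ i ω ≤ S} := fun i =>
    M.measurable_τ_orderFlow i measurableSet_Iic
  have hW : ∀ i, Measurable[M.orderFlow] (W i) := fun i =>
    Measurable.ite (hτS i) (M.measurable_Y_orderFlow x |x| i) measurable_const
  have hW' : ∀ i, Measurable (W i) := fun i => (hW i).mono M.orderFlow_le le_rfl
  have hsum : ∀ ω n, ∑ i ∈ Finset.range n, |W i ω| ≤ |x| := fun ω n => by
    refine le_trans (Finset.sum_le_sum fun i _ => ?_) (M.sum_abs_Y_le hx n ω)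
    simp only [W]
    split_ifs <;> simp
  have hWb : ∀ i ω, ‖W i ω‖ ≤ |x| := fun i ω =>
    (Finset.single_le_sum (f := fun i => |W i ω|) (fun _ _ => abs_nonneg _)
      (Finset.self_mem_range_succ i)).trans (hsum ω (i + 1))
  have hWi : ∀ i, Integrable (W i) μ := fun i =>
    Integrable.of_bound (hW' i).aestronglyMeasurable |x| (Eventually.of_forall (hWb i))
  have hWs : Summable fun i => ∫ ω, ‖W i ω‖ ∂μ := by
    refine summable_of_sum_range_le (c := |x|) (fun i => integral_nonneg fun _ => norm_nonneg _)
      fun n => ?_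
    rw [← integral_finsetSum _ fun i _ => (hWi i).norm]
    calc ∫ ω, ∑ i ∈ Finset.range n, ‖W i ω‖ ∂μ ≤ ∫ _, |x| ∂μ :=
          integral_mono (integrable_finsetSum _ fun i _ => (hWi i).norm) (integrable_const _)
            fun ω => hsum ω n
      _ = |x| := by simp
  have hF := fun i => hM.integral_mul_P0 (T := S) (σ := fun ω => min (M.τ i ω) S) (hW i)
    ((M.measurable_τ_orderFlow i).min measurable_const) (fun ω => min_le_right _ _) (hWi i)
  have hFs : Summable fun i => ∫ ω, ‖F i ω‖ ∂μ :=
    Summable.of_nonneg_of_le (fun i => integral_nonneg fun _ => norm_nonneg _)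
      (fun i => (hF i).2.2) (hWs.mul_left _)
  have hFeq : ∀ ω, ∑ i ∈ Finset.range (M.N S ω), M.Y x |x| i ω * M.P0 (M.τ i ω) ω
      = ∑' i, F i ω := fun ω => by
    rw [sum_range_N_eq_tsum]
    refine tsum_congr fun i => ?_
    simp only [F, W]
    split_ifs with h
    · rw [min_eq_left h]
    · rw [zero_mul]
  have hZeq : ∀ ω, M.Z x |x| S ω = ∑' i, W i ω := fun ω => sum_range_N_eq_tsum M S ω _
  have hmeas : Measurable fun ω =>
      ∑ i ∈ Finset.range (M.N S ω), M.Y x |x| i ω * M.P0 (M.τ i ω) ω :=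
    measurable_sum_range (M.measurable_N S) fun i => (M.measurable_Y x |x| i).mul
      (M.measurable_P0_eval.comp (measurable_id.prodMk (M.measurable_τ i)))
  simp only [hFeq, hZeq] at hmeas ⊢
  refine ⟨integrable_tsum_of_summable_integral_norm (fun i => (hF i).1) hFs
    hmeas.aestronglyMeasurable, ?_⟩
  rw [← (hasSum_integral_of_summable_integral_norm (fun i => (hF i).1) hFs).tsum_eq,
    ← (hasSum_integral_of_summable_integral_norm hWi hWs).tsum_eq, ← tsum_mul_left]
  exact tsum_congr fun i => (hF i).2.1

lemma PoissonArrivals.integral_exchange (hM : M.PoissonArrivals θ ν) {ξ : ℝ≥0 → Ω → ℝ}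
    (hξm : Measurable fun p : Ω × ℝ≥0 => ξ p.2 p.1) (hξ : ∀ t, Measurable[M.orderFlow] (ξ t))
    {C : ℝ} (hC : ∀ t ω, |ξ t ω| ≤ C) (T : ℝ≥0) :
    (∀ᵐ ω ∂μ, TimeIntegrable (fun t => ξ t ω * M.P0 t ω) T) ∧
      Integrable (fun ω => timeIntegral (fun t => ξ t ω * M.P0 t ω) T) μ ∧
      ∫ ω, timeIntegral (fun t => ξ t ω * M.P0 t ω) T ∂μ
        = (∫ ω, M.P0 0 ω ∂μ) * ∫ ω, timeIntegral (fun t => ξ t ω) T ∂μ := by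
  let lam : Measure ℝ := volume.restrict (Set.Ioc 0 (T : ℝ))
  have hpair : Measurable fun p : Ω × ℝ => (p.1, p.2.toNNReal) :=
    measurable_fst.prodMk (measurable_real_toNNReal.comp measurable_snd)
  have hP : Measurable fun p : Ω × ℝ => M.P0 p.2.toNNReal p.1 := M.measurable_P0_eval.comp hpair
  have hξ2 : Measurable fun p : Ω × ℝ => ξ p.2.toNNReal p.1 := hξm.comp hpair
  have hPi : Integrable (fun p : Ω × ℝ => M.P0 p.2.toNNReal p.1) (μ.prod lam) := by
    rw [integrable_prod_iff' hP.aestronglyMeasurable]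
    refine ⟨Eventually.of_forall fun u => M.martingale.integrable u.toNNReal, ?_⟩
    refine Integrable.of_bound
      hP.norm.stronglyMeasurable.integral_prod_left'.aestronglyMeasurable
      (∫ ω, |M.P0 T ω| ∂μ) ?_
    refine (ae_restrict_iff' measurableSet_Ioc).2 (Eventually.of_forall fun u hu => ?_)
    rw [Real.norm_of_nonneg (integral_nonneg fun _ => norm_nonneg _)]
    exact M.integral_abs_P0_le (Real.toNNReal_le_iff_le_coe.2 hu.2)
  have hξi : Integrable (fun p : Ω × ℝ => ξ p.2.toNNReal p.1) (μ.prod lam) :=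
    Integrable.of_bound hξ2.aestronglyMeasurable C (Eventually.of_forall fun p => hC _ _)
  have hf : Integrable (fun p : Ω × ℝ => ξ p.2.toNNReal p.1 * M.P0 p.2.toNNReal p.1)
      (μ.prod lam) :=
    hPi.bdd_mul (c := C) hξ2.aestronglyMeasurable (Eventually.of_forall fun p => hC _ _)
  have htI : ∀ g : ℝ≥0 → ℝ, timeIntegral g T = ∫ u, g u.toNNReal ∂lam := fun g =>
    intervalIntegral.integral_of_le T.coe_nonneg
  refine ⟨?_, ?_, ?_⟩
  · filter_upwards [hf.prod_right_ae] with ω hω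
    exact (intervalIntegrable_iff_integrableOn_Ioc_of_le T.coe_nonneg).2 hω
  · simp only [htI]
    exact hf.integral_prod_left
  · simp only [htI]
    rw [integral_integral_swap (f := fun ω (u : ℝ) => ξ u.toNNReal ω * M.P0 u.toNNReal ω) hf,
      integral_integral_swap (f := fun ω (u : ℝ) => ξ u.toNNReal ω) hξi, ← integral_const_mul]
    refine integral_congr_ae (Eventually.of_forall fun u => ?_)
    exact (hM.integral_mul_P0 (T := u.toNNReal) (σ := fun _ => u.toNNReal) (hξ _)
      measurable_const (fun _ => le_rfl) (Integrable.of_bound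
      ((hξ _).mono M.orderFlow_le le_rfl).aestronglyMeasurable C
      (Eventually.of_forall (hC _)))).2.1

end Model
-- Expected cost of the manipulation strategy.
namespace Model

variable {Ω : Type*} [mΩ : MeasurableSpace Ω] {μ : Measure Ω} {M : Model μ}

/-- The part of the costs of `buildUp` that involves neither the unaffected price nor the temporary
impact of the final liquidation. -/
noncomputable def buildUpCost (M : Model μ) (η X₀ x c : ℝ) (S : ℝ≥0) (ω : Ω) : ℝ :=
  M.γ / 2 * (X₀ + M.Z x |x| S ω) ^ 2 + η * c ^ 2 * min (M.τ 0 ω : ℝ) S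
    + M.γ * c * (min (M.τ 0 ω : ℝ) S * M.Z x |x| S ω)

/-- Every arrival up to `S` comes no earlier than the first one, when exchange trading stops, so all
dark executions see the same displacement. -/
lemma darkPrice_buildUp (hκ : M.κ = 0) (X₀ x c : ℝ) {S T : ℝ≥0} {ω : Ω} {i : ℕ}
    (hi : i < M.N S ω) :
    M.darkPrice (M.buildUp X₀ x c S T) i ω
      = M.P0 (M.τ i ω) ω + M.γ * (c * min (M.τ 0 ω : ℝ) S) := by
  have h1 : M.τ i ω ≤ S := (M.lt_N_iff S ω i).1 hi
  have h2 : M.τ 0 ω ≤ M.τ i ω := (M.τ_strictMono ω).monotone (Nat.zero_le i)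
  rw [darkPrice, hκ, zero_mul, add_zero, buildUp_ξ, timeIntegral_twoPhase_of_le _ _ _ _ h1,
    min_eq_left (NNReal.coe_le_coe.2 h2), min_eq_left (NNReal.coe_le_coe.2 (h2.trans h1))]

lemma cost_buildUp (hα : M.α = 0) (hβ : ∀ y, M.β y = 0) (hκ : M.κ = 0) {η : ℝ}
    (hη : ∀ x, M.h x = η * x) (X₀ x c : ℝ) {S T : ℝ≥0} (hST : S < T) {ω : Ω}
    (hω : TimeIntegrable (fun t => (M.buildUp X₀ x c S T).ξ t ω * M.P0 t ω) T) :
    M.cost X₀ T (M.buildUp X₀ x c S T) ω =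
      ((X₀ * M.P0 0 ω + timeIntegral (fun t => (M.buildUp X₀ x c S T).ξ t ω * M.P0 t ω) T
        + ∑ i ∈ Finset.range (M.N S ω), M.Y x |x| i ω * M.P0 (M.τ i ω) ω
        + (M.buildUpCost η X₀ x c S ω + η * (M.exitSpeed X₀ x c S T ω ^ 2 * (T - S))) : ℝ) :
        EReal) := by
  have himp := timeIntegral_twoPhase_impact c (M.exitSpeed X₀ x c S T ω) (M.τ 0 ω) S M.γ η hST.le
  have hprice : (fun t => (M.buildUp X₀ x c S T).ξ t ω * M.exchangePrice (M.buildUp X₀ x c S T) t ω)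
      = fun t => (M.buildUp X₀ x c S T).ξ t ω * M.P0 t ω +
        twoPhase c (M.exitSpeed X₀ x c S T ω) (M.τ 0 ω) S t *
        (M.γ * timeIntegral (twoPhase c (M.exitSpeed X₀ x c S T ω) (M.τ 0 ω) S) t
          + η * twoPhase c (M.exitSpeed X₀ x c S T ω) (M.τ 0 ω) S t) := by
    ext t
    rw [exchangePrice, hη, buildUp_ξ, ← congr_fun (M.buildUp_ξ X₀ x c S T ω) t]
    ring
  have hint : TimeIntegrable (fun t => (M.buildUp X₀ x c S T).ξ t ω *
      M.exchangePrice (M.buildUp X₀ x c S T) t ω) T := by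
    rw [hprice]
    exact IntervalIntegrable.add hω himp.1
  have hval : timeIntegral (fun t => (M.buildUp X₀ x c S T).ξ t ω *
      M.exchangePrice (M.buildUp X₀ x c S T) t ω) T
      = timeIntegral (fun t => (M.buildUp X₀ x c S T).ξ t ω * M.P0 t ω) T + (M.γ / 2 *
        (c * min (M.τ 0 ω : ℝ) S + M.exitSpeed X₀ x c S T ω * (T - S)) ^ 2
        + η * (c ^ 2 * min (M.τ 0 ω : ℝ) S + M.exitSpeed X₀ x c S T ω ^ 2 * (T - S))) := by
    rw [hprice, ← himp.2]
    exact intervalIntegral.integral_add hω himp.1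
  have hsum : ∑ i ∈ Finset.range (M.N S ω), M.Y x |x| i ω *
      (M.darkPrice (M.buildUp X₀ x c S T) i ω + 0 * M.γ * ∑ j ∈ Finset.range i, M.Y x |x| j ω
        + M.β (M.Y x |x| i ω))
      = ∑ i ∈ Finset.range (M.N S ω), M.Y x |x| i ω * M.P0 (M.τ i ω) ω
        + M.γ * (c * min (M.τ 0 ω : ℝ) S) * M.Z x |x| S ω := by
    rw [Z, Finset.mul_sum, ← Finset.sum_add_distrib]
    refine Finset.sum_congr rfl fun i hi => ?_
    rw [darkPrice_buildUp hκ X₀ x c (Finset.mem_range.1 hi), hβ]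
    ring
  rw [cost, exchangeExpense, if_pos hint, hval, hα, ← EReal.coe_add]
  congr 1
  change _ + (_ + _ + ∑ i ∈ Finset.range (M.N S ω), M.Y x |x| i ω *
      (M.darkPrice (M.buildUp X₀ x c S T) i ω + 0 * M.γ * ∑ j ∈ Finset.range i, M.Y x |x| j ω
        + M.β (M.Y x |x| i ω))) = _
  rw [hsum, M.exitSpeed_mul hST, buildUpCost]
  ring

lemma measurable_exitSpeed (M : Model μ) (X₀ x c : ℝ) (S T : ℝ≥0) :
    Measurable[M.orderFlow] (M.exitSpeed X₀ x c S T) := by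
  have h1 := M.measurable_Z_orderFlow x |x| S
  have h2 := measurable_coe_nnreal_real.comp ((M.measurable_τ_orderFlow 0).min
    (measurable_const (a := S)))
  exact (((measurable_const.add h1).add (h2.const_mul c)).neg).div_const _

lemma abs_buildUp_ξ_le (M : Model μ) {x : ℝ} (hx : x ≠ 0) (X₀ c : ℝ) {S T : ℝ≥0} (hST : S < T)
    (t : ℝ≥0) (ω : Ω) :
    |(M.buildUp X₀ x c S T).ξ t ω| ≤ |c| + (|X₀| + |x| + |c| * S) / (T - S) := by
  have h0 : (0 : ℝ) < T - S := sub_pos.2 hST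
  have h1 : 0 ≤ (|X₀| + |x| + |c| * S) / (T - S) := by positivity
  have h2 : |M.exitSpeed X₀ x c S T ω| ≤ (|X₀| + |x| + |c| * S) / (T - S) := by
    rw [exitSpeed, abs_div, abs_neg, abs_of_pos h0, NNReal.coe_min]
    gcongr
    exact M.abs_exitPosition_le hx X₀ c S ω
  rw [congr_fun (M.buildUp_ξ X₀ x c S T ω) t, twoPhase]
  split_ifs
  · exact le_add_of_nonneg_right h1
  · rw [abs_zero]
    positivity
  · exact h2.trans (le_add_of_nonneg_left (abs_nonneg c))

lemma measurable_buildUpCost (M : Model μ) (η X₀ x c : ℝ) (S : ℝ≥0) :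
    Measurable (M.buildUpCost η X₀ x c S) := by
  have h1 := M.measurable_Z x |x| S
  have h2 := M.measurable_τ 0
  unfold buildUpCost
  fun_prop

/-- Keeping `min τ₀ S` in the bound serves twice: it gives integrability at fixed `S`, and a
dominating function as `S → ∞`. -/
lemma abs_buildUpCost_le (M : Model μ) {x : ℝ} (hx : x ≠ 0) (η X₀ c : ℝ) (S : ℝ≥0) (ω : Ω) :
    |M.buildUpCost η X₀ x c S ω| ≤ |M.γ / 2| * (|X₀| + |x|) ^ 2
      + (|η * c ^ 2| + |M.γ * c| * |x|) * min (M.τ 0 ω : ℝ) S := by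
  have hZ := M.abs_Z_le hx S ω
  have hm : (0 : ℝ) ≤ min (M.τ 0 ω : ℝ) S := by positivity
  have h1 : |X₀ + M.Z x |x| S ω| ≤ |X₀| + |x| :=
    (abs_add_le _ _).trans (add_le_add le_rfl hZ)
  rw [buildUpCost, add_mul, ← add_assoc]
  refine (abs_add_le _ _).trans (add_le_add ((abs_add_le _ _).trans (add_le_add ?_ ?_)) ?_)
  · rw [abs_mul, abs_pow]
    gcongr
  · rw [abs_mul, abs_of_nonneg hm]
  · rw [abs_mul, abs_mul (min _ _), abs_of_nonneg hm, mul_assoc, mul_comm (min _ _)]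
    gcongr

variable [IsProbabilityMeasure μ] {θ : ℝ≥0} {ν : Measure ℝ≥0∞}

lemma PoissonArrivals.infExpectedCost_le (hM : M.PoissonArrivals θ ν) (hα : M.α = 0)
    (hβ : ∀ y, M.β y = 0) (hκ : M.κ = 0) {η : ℝ} (hη0 : 0 < η) (hη : ∀ x, M.h x = η * x) {x : ℝ}
    (hx : x ≠ 0) (X₀ c : ℝ) {S T : ℝ≥0} (hST : S < T) :
    M.infExpectedCost X₀ T ≤ ((∫ ω, M.buildUpCost η X₀ x c S ω ∂μ
      + η * (|X₀| + |x| + |c| * S) ^ 2 * (T - S : ℝ)⁻¹ : ℝ) : EReal) := by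
  have h0 : (0 : ℝ) < T - S := sub_pos.2 hST
  set K : ℝ := |X₀| + |x| + |c| * S with hK
  have hd := (M.measurable_exitSpeed X₀ x c S T)
  have hd' : Measurable (M.exitSpeed X₀ x c S T) := hd.mono M.orderFlow_le le_rfl
  have hξm : Measurable fun p : Ω × ℝ≥0 => (M.buildUp X₀ x c S T).ξ p.2 p.1 := by
    refine Measurable.ite (measurableSet_le measurable_snd measurable_const)
      (Measurable.ite (measurableSet_le measurable_snd ((M.measurable_τ 0).comp measurable_fst))
        measurable_const measurable_const) (hd'.comp measurable_fst)
  have hξ : ∀ t, Measurable[M.orderFlow] ((M.buildUp X₀ x c S T).ξ t) := fun t => by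
    refine Measurable.ite (MeasurableSet.const _) (Measurable.ite ?_ measurable_const
      measurable_const) hd
    exact M.measurable_τ_orderFlow 0 measurableSet_Ici
  obtain ⟨hTI, hEi, hE⟩ := hM.integral_exchange hξm hξ
    (M.abs_buildUp_ξ_le hx X₀ c hST) T
  obtain ⟨hDi, hD⟩ := hM.integral_dark hx S
  have hZi : Integrable (M.Z x |x| S) μ :=
    Integrable.of_bound (M.measurable_Z x |x| S).aestronglyMeasurable |x|
      (Eventually.of_forall fun ω => M.abs_Z_le hx S ω)
  have hPi : Integrable (fun ω => X₀ * M.P0 0 ω) μ := (M.martingale.integrable 0).const_mul X₀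
  have hxT : ∀ ω, timeIntegral (fun t => (M.buildUp X₀ x c S T).ξ t ω) T
      = -X₀ - M.Z x |x| S ω := fun ω => by
    rw [buildUp_ξ, (timeIntegral_twoPhase _ _ _ _ hST.le).2, M.exitSpeed_mul hST]
    ring
  have hBi : Integrable (M.buildUpCost η X₀ x c S) μ :=
    Integrable.of_bound (M.measurable_buildUpCost η X₀ x c S).aestronglyMeasurable
      (|M.γ / 2| * (|X₀| + |x|) ^ 2 + (|η * c ^ 2| + |M.γ * c| * |x|) * S)
      (Eventually.of_forall fun ω => (M.abs_buildUpCost_le hx η X₀ c S ω).trans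
        (by gcongr; exact min_le_right _ _))
  -- The exit closes a position of size at most `K` at constant speed over a period of length `T -
  -- S`.
  have hLb : ∀ ω, η * (M.exitSpeed X₀ x c S T ω ^ 2 * (T - S)) ≤ η * K ^ 2 * (T - S : ℝ)⁻¹ :=
    fun ω => by
      have h1 : M.exitSpeed X₀ x c S T ω ^ 2 * (T - S)
          = (M.exitSpeed X₀ x c S T ω * (T - S)) ^ 2 * (T - S : ℝ)⁻¹ := by
        field_simp
      rw [h1, M.exitSpeed_mul hST, neg_sq, ← sq_abs, mul_assoc]
      gcongr
      exact M.abs_exitPosition_le hx X₀ c S ω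
  have hLi : Integrable (fun ω => η * (M.exitSpeed X₀ x c S T ω ^ 2 * (T - S))) μ :=
    Integrable.of_bound (((hd'.pow_const 2).mul_const _).const_mul η).aestronglyMeasurable
      (η * K ^ 2 * (T - S : ℝ)⁻¹) (Eventually.of_forall fun ω => by
        rw [Real.norm_of_nonneg (by positivity)]
        exact hLb ω)
  refine (iInf_le _ ⟨_, M.isAdmissible_buildUp hx X₀ c hST⟩).trans ?_
  rw [expectation_congr (hTI.mono fun ω hω => cost_buildUp hα hβ hκ hη X₀ x c hST hω),
    expectation_coe (((hPi.fun_add hEi).fun_add hDi).fun_add (hBi.fun_add hLi)), EReal.coe_le_coe_iff,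
    integral_add ((hPi.fun_add hEi).fun_add hDi) (hBi.fun_add hLi), integral_add (hPi.fun_add hEi) hDi,
    integral_add hPi hEi, integral_add hBi hLi, hE, hD, integral_const_mul]
  simp only [hxT]
  rw [integral_sub (integrable_const _) hZi, integral_const, probReal_univ, one_smul]
  have hL : ∫ ω, η * (M.exitSpeed X₀ x c S T ω ^ 2 * (T - S)) ∂μ ≤ η * K ^ 2 * (T - S : ℝ)⁻¹ :=
    (integral_mono hLi (integrable_const _) hLb).trans (by simp)
  -- With `p` the mean price, the price terms `X₀ p`, `(-X₀ - E Z) p` and `(E Z) p` cancel.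
  linarith

end Model
-- First arrival, eventual fill, and the limits in `T` and `S`.
namespace Model

variable {Ω : Type*} [mΩ : MeasurableSpace Ω] {μ : Measure Ω} {M : Model μ} {θ : ℝ≥0}
  {ν : Measure ℝ≥0∞}

lemma PoissonArrivals.measure_lt_τ_zero (hM : M.PoissonArrivals θ ν) (t : ℝ≥0) :
    μ {ω | t < M.τ 0 ω} = ENNReal.ofReal (Real.exp (-(θ * t))) := by
  have hN0 : ∀ ω, M.N 0 ω = 0 := fun ω => Nat.le_zero.1 ((M.N_le_iff 0 ω 0).2 (M.τ_pos ω))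
  have h := (hM.poisson.law 0 t zero_le).measure_eq (p := fun n => n = 0)
    (MeasurableSet.of_discrete)
  have h1 : {ω | t < M.τ 0 ω} = {ω | M.N t ω - M.N 0 ω = 0} := by
    ext ω
    simp only [Set.mem_ofPred_eq, hN0, tsub_zero, ← M.N_le_iff, Nat.le_zero]
  rw [h1, h]
  change poissonMeasure _ {0} = _
  rw [poissonMeasure_singleton]
  simp

lemma PoissonArrivals.lintegral_τ_zero (hM : M.PoissonArrivals θ ν) :
    ∫⁻ ω, ENNReal.ofReal (M.τ 0 ω) ∂μ = ENNReal.ofReal (1 / θ) := by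
  have hθ : (0 : ℝ) < θ := hM.θ_pos
  -- Layer-cake formula: the mean is the integral of the exponential survival function.
  rw [lintegral_eq_lintegral_meas_lt μ (f := fun ω => (M.τ 0 ω : ℝ))
    (Eventually.of_forall fun ω => NNReal.coe_nonneg _)
    (measurable_coe_nnreal_real.comp (M.measurable_τ 0)).aemeasurable]
  have h1 : ∀ t ∈ Set.Ioi (0 : ℝ), μ {ω | t < (M.τ 0 ω : ℝ)}
      = ENNReal.ofReal (Real.exp (-θ * t)) := fun t ht => by
    have := hM.measure_lt_τ_zero ⟨t, le_of_lt ht⟩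
    rw [neg_mul]
    exact this
  rw [setLIntegral_congr_fun measurableSet_Ioi h1,
    ← ofReal_integral_eq_lintegral_ofReal (integrableOn_exp_mul_Ioi (by linarith) 0)
      (Eventually.of_forall fun _ => (Real.exp_pos _).le),
    integral_exp_mul_Ioi (by linarith)]
  simp

lemma PoissonArrivals.integrable_τ_zero (hM : M.PoissonArrivals θ ν) :
    Integrable (fun ω => (M.τ 0 ω : ℝ)) μ := by
  refine (lintegral_ofReal_ne_top_iff_integrable
    (measurable_coe_nnreal_real.comp (M.measurable_τ 0)).aestronglyMeasurable
    (Eventually.of_forall fun ω => NNReal.coe_nonneg _)).1 ?_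
  exact (hM.lintegral_τ_zero).trans_ne ENNReal.ofReal_ne_top

lemma PoissonArrivals.integral_τ_zero (hM : M.PoissonArrivals θ ν) :
    ∫ ω, (M.τ 0 ω : ℝ) ∂μ = 1 / θ := by
  rw [integral_eq_lintegral_of_nonneg_ae (Eventually.of_forall fun ω => NNReal.coe_nonneg _)
    (measurable_coe_nnreal_real.comp (M.measurable_τ 0)).aestronglyMeasurable,
    hM.lintegral_τ_zero, ENNReal.toReal_ofReal (by positivity)]

variable [IsProbabilityMeasure μ]

/-- Second Borel–Cantelli: the events are independent with a common positive probability, so almost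
surely infinitely many occur. -/
lemma PoissonArrivals.ae_exists_size_ge (hM : M.PoissonArrivals θ ν) {x : ℝ} (hx : 0 < x) :
    ∀ᵐ ω ∂μ, ∃ j, ENNReal.ofReal x ≤ M.Ytilde j ω := by
  have hm : ∀ j, MeasurableSet {ω | ENNReal.ofReal x ≤ M.Ytilde j ω} := fun j =>
    M.measurable_Ytilde j measurableSet_Ici
  have hq : ∀ j, μ {ω | ENNReal.ofReal x ≤ M.Ytilde j ω} = ν (Set.Ici (ENNReal.ofReal x)) :=
    fun j => by
      rw [← hM.size_law j, Measure.map_apply (M.measurable_Ytilde j) measurableSet_Ici]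
      rfl
  have hpos : ν (Set.Ici (ENNReal.ofReal x)) ≠ 0 :=
    (hM.size_unbounded x.toNNReal (Real.toNNReal_pos.2 hx)).ne'
  have hind : iIndepSet (fun j => {ω | ENNReal.ofReal x ≤ M.Ytilde j ω}) μ := by
    rw [iIndepSet_iff_meas_biInter hm]
    intro s
    exact hM.size_indep.measure_inter_preimage_eq_mul s
      (sets := fun _ => Set.Ici (ENNReal.ofReal x)) fun _ _ => measurableSet_Ici
  have h1 := measure_limsup_eq_one hm hind (by
    simp only [hq]
    exact ENNReal.tsum_const_eq_top_of_ne_zero hpos)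
  have h2 : ∀ᵐ ω ∂μ, ω ∈ limsup (fun j => {ω | ENNReal.ofReal x ≤ M.Ytilde j ω}) atTop :=
    (prob_compl_eq_zero_iff (MeasurableSet.measurableSet_limsup hm)).2 h1
  filter_upwards [h2] with ω hω
  rw [mem_limsup_iff_frequently_mem] at hω
  exact hω.exists

/-- An order that is kept in the dark pool is eventually filled. -/
lemma PoissonArrivals.ae_eventually_Z_eq (hM : M.PoissonArrivals θ ν) {x : ℝ} (hx : x ≠ 0) :
    ∀ᵐ ω ∂μ, ∀ᶠ S in atTop, M.Z x |x| S ω = x := by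
  filter_upwards [hM.ae_exists_size_ge (abs_pos.2 hx)] with ω ⟨j, hj⟩
  filter_upwards [eventually_ge_atTop (M.τ j ω)] with S hS
  rw [M.Z_of_full hx, if_pos ⟨j, (M.lt_N_iff S ω j).2 hS, hj⟩]

lemma PoissonArrivals.tendsto_integral_buildUpCost (hM : M.PoissonArrivals θ ν) {x : ℝ}
    (hx : x ≠ 0) (η X₀ c : ℝ) :
    Tendsto (fun S => ∫ ω, M.buildUpCost η X₀ x c S ω ∂μ) atTop
      (𝓝 (M.γ / 2 * (X₀ + x) ^ 2 + (η * c ^ 2 + M.γ * c * x) / θ)) := by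
  have hlim : ∫ ω, (M.γ / 2 * (X₀ + x) ^ 2 + (η * c ^ 2 + M.γ * c * x) * M.τ 0 ω) ∂μ
      = M.γ / 2 * (X₀ + x) ^ 2 + (η * c ^ 2 + M.γ * c * x) / θ := by
    rw [integral_add (integrable_const _) (hM.integrable_τ_zero.const_mul _), integral_const,
      probReal_univ, one_smul, integral_const_mul, hM.integral_τ_zero]
    ring
  rw [← hlim]
  refine tendsto_integral_filter_of_dominated_convergence (fun ω => |M.γ / 2| * (|X₀| + |x|) ^ 2
      + (|η * c ^ 2| + |M.γ * c| * |x|) * M.τ 0 ω)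
    (Eventually.of_forall fun S => (M.measurable_buildUpCost η X₀ x c S).aestronglyMeasurable)
    (Eventually.of_forall fun S => Eventually.of_forall fun ω =>
      (M.abs_buildUpCost_le hx η X₀ c S ω).trans (by gcongr; exact min_le_left _ _))
    ((integrable_const _).add (hM.integrable_τ_zero.const_mul _)) ?_
  filter_upwards [hM.ae_eventually_Z_eq hx] with ω hω
  refine tendsto_const_nhds.congr' ?_
  filter_upwards [hω, eventually_ge_atTop (M.τ 0 ω)] with S hZ hS
  rw [buildUpCost, hZ, min_eq_left (NNReal.coe_le_coe.2 hS)]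
  ring

lemma PoissonArrivals.iInf_infExpectedCost_le (hM : M.PoissonArrivals θ ν) (hα : M.α = 0)
    (hβ : ∀ y, M.β y = 0) (hκ : M.κ = 0) {η : ℝ} (hη0 : 0 < η) (hη : ∀ x, M.h x = η * x)
    (X₀ : ℝ) {x : ℝ} (hx : x ≠ 0) :
    ⨅ T, M.infExpectedCost X₀ T ≤
      ((M.γ / 2 * (X₀ + x) ^ 2 - M.γ ^ 2 * x ^ 2 / (4 * η * θ) : ℝ) : EReal) := by
  have hθ : (0 : ℝ) < θ := hM.θ_pos
  -- This speed minimises `η c² + γ c x`.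
  set c : ℝ := -(M.γ * x / (2 * η)) with hc
  have hv : M.γ / 2 * (X₀ + x) ^ 2 - M.γ ^ 2 * x ^ 2 / (4 * η * θ)
      = M.γ / 2 * (X₀ + x) ^ 2 + (η * c ^ 2 + M.γ * c * x) / θ := by
    rw [hc]
    field_simp
    ring
  rw [hv]
  -- Outer limit `S → ∞`; for each fixed `S` the limit `T → ∞` first removes the exit cost.
  refine ge_of_tendsto ((continuous_coe_real_ereal.tendsto _).comp
    (hM.tendsto_integral_buildUpCost hx η X₀ c)) (Eventually.of_forall fun S => ?_)
  have h1 : Tendsto (fun T : ℝ≥0 => ∫ ω, M.buildUpCost η X₀ x c S ω ∂μ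
      + η * (|X₀| + |x| + |c| * S) ^ 2 * ((T : ℝ) - S)⁻¹) atTop
      (𝓝 (∫ ω, M.buildUpCost η X₀ x c S ω ∂μ + η * (|X₀| + |x| + |c| * S) ^ 2 * 0)) := by
    refine tendsto_const_nhds.add (Tendsto.const_mul _ (tendsto_inv_atTop_zero.comp ?_))
    exact tendsto_atTop_add_const_right _ (-(S : ℝ)) (NNReal.tendsto_coe_atTop.2 tendsto_id)
  rw [mul_zero, add_zero] at h1
  refine ge_of_tendsto ((continuous_coe_real_ereal.tendsto _).comp h1) ?_
  filter_upwards [eventually_gt_atTop S] with T hT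
  exact (iInf_le _ T).trans (hM.infExpectedCost_le hα hβ hκ hη0 hη hx X₀ c hT)

end Model
-- Monotonicity in the time horizon.
section stopped

variable {f : ℝ≥0 → ℝ} {T : ℝ≥0}

/-- A function that is replaced by `0` after time `T`. -/
noncomputable def cutoff (T : ℝ≥0) (f : ℝ≥0 → ℝ) (t : ℝ≥0) : ℝ := if t ≤ T then f t else 0

lemma timeIntegral_cutoff_of_le {t : ℝ≥0} (h : t ≤ T) :
    timeIntegral (cutoff T f) t = timeIntegral f t := by
  refine intervalIntegral.integral_congr_ae (Eventually.of_forall fun u hu => ?_)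
  rw [Set.uIoc_of_le t.coe_nonneg] at hu
  rw [cutoff, if_pos ((Real.toNNReal_le_iff_le_coe.2 hu.2).trans h)]

lemma eqOn_cutoff {t : ℝ≥0} (h : T ≤ t) :
    Set.EqOn (fun _ => (0 : ℝ)) (fun s : ℝ => cutoff T f s.toNNReal) (Set.uIoc T t) := fun u hu => by
  rw [Set.uIoc_of_le (NNReal.coe_le_coe.2 h)] at hu
  simp [cutoff, Real.toNNReal_le_iff_le_coe, hu.1.not_ge]

lemma timeIntegrable_cutoff_iff {t : ℝ≥0} (h : T ≤ t) :
    TimeIntegrable (cutoff T f) t ↔ TimeIntegrable f T := by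
  have h1 : TimeIntegrable (cutoff T f) T ↔ TimeIntegrable f T := by
    refine intervalIntegrable_congr fun u hu => ?_
    rw [Set.uIoc_of_le T.coe_nonneg] at hu
    simp only [cutoff, if_pos (Real.toNNReal_le_iff_le_coe.2 hu.2)]
  rw [← h1]
  constructor
  · intro hi
    refine IntervalIntegrable.mono_set hi ?_
    rw [Set.uIcc_of_le T.coe_nonneg, Set.uIcc_of_le t.coe_nonneg]
    exact Set.Icc_subset_Icc_right h
  · intro hi
    exact IntervalIntegrable.trans hi ((intervalIntegrable_const (c := (0 : ℝ))).congr
      (eqOn_cutoff h))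

lemma timeIntegral_cutoff {t : ℝ≥0} (h : T ≤ t) (hf : TimeIntegrable f T) :
    timeIntegral (cutoff T f) t = timeIntegral f T := by
  have h1 : TimeIntegrable (cutoff T f) T := (timeIntegrable_cutoff_iff le_rfl).2 hf
  rw [← timeIntegral_cutoff_of_le (f := f) le_rfl, timeIntegral, timeIntegral,
    ← intervalIntegral.integral_add_adjacent_intervals h1
      ((intervalIntegrable_const (c := (0 : ℝ))).congr (eqOn_cutoff h)),
    ← intervalIntegral.integral_congr_ae (Eventually.of_forall (eqOn_cutoff (f := f) h))]
  simp

end stopped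

namespace Model

variable {Ω : Type*} [mΩ : MeasurableSpace Ω] {μ : Measure Ω} {M : Model μ}

/-- The strategy that does not trade at the exchange after time `T`. -/
noncomputable def _root_.DarkPool.Strategy.stopAt (χ : Strategy Ω) (T : ℝ≥0) : Strategy Ω where
  Xhat := χ.Xhat
  Xi := χ.Xi
  ξ t ω := cutoff T (fun s => χ.ξ s ω) t
  ρ := χ.ρ

lemma IsAdmissible.stopAt {X₀ : ℝ} {T T' : ℝ≥0} (hT : T ≤ T') {χ : Strategy Ω}
    (hχ : M.IsAdmissible X₀ T χ) : M.IsAdmissible X₀ T' (χ.stopAt T) where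
  Xi_mem := hχ.Xi_mem
  stopping := hχ.stopping
  lt_horizon := hχ.lt_horizon.mono fun ω h => h.trans_le hT
  predictable := by
    have h := StronglyMeasurable.indicator hχ.predictable
      (measurableSet_predictable_Ioi (M.G χ.Xhat χ.Xi) T).compl
    refine (congrArg (StronglyMeasurable[(M.G χ.Xhat χ.Xi).predictable]) ?_).mp h
    ext ⟨t, ω⟩
    simp [Function.uncurry, Strategy.stopAt, cutoff, Set.indicator, not_lt]
  integrable := hχ.integrable.mono fun ω h => (timeIntegrable_cutoff_iff hT).2 h
  bounded := by
    obtain ⟨K, hK⟩ := hχ.bounded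
    refine ⟨K, ?_⟩
    filter_upwards [hK, hχ.integrable] with ω h hi t _
    rcases le_total t T with ht | ht
    · exact (congrArg abs (timeIntegral_cutoff_of_le ht)).trans_le (h t ht)
    · exact (congrArg abs (timeIntegral_cutoff ht hi)).trans_le (h T le_rfl)
  liquidation := by
    filter_upwards [hχ.liquidation, hχ.integrable] with ω h hi
    have : timeIntegral (fun s => (χ.stopAt T).ξ s ω) T' = timeIntegral (fun s => χ.ξ s ω) T :=
      timeIntegral_cutoff hT hi
    rw [this]
    exact h

/-- The dark order is cancelled before `T`, so every dark execution sees the original exchange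
trades, and idle time after `T` costs nothing. -/
lemma cost_stopAt (hα : M.α = 0) (hκ : M.κ = 0) {X₀ : ℝ} {T T' : ℝ≥0} (hT : T ≤ T')
    {χ : Strategy Ω} {ω : Ω} (hρ : χ.ρ ω < T) :
    M.cost X₀ T' (χ.stopAt T) ω = M.cost X₀ T χ ω := by
  have hprice : (fun t => (χ.stopAt T).ξ t ω * M.exchangePrice (χ.stopAt T) t ω)
      = cutoff T fun t => χ.ξ t ω * M.exchangePrice χ t ω := by
    ext t
    by_cases ht : t ≤ T
    · have h1 : (χ.stopAt T).ξ t ω = χ.ξ t ω := if_pos ht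
      have h2 : timeIntegral (fun s => (χ.stopAt T).ξ s ω) t = timeIntegral (fun s => χ.ξ s ω) t :=
        timeIntegral_cutoff_of_le ht
      rw [exchangePrice, h1, h2, cutoff, if_pos ht, exchangePrice]
    · have h1 : (χ.stopAt T).ξ t ω = 0 := if_neg ht
      rw [h1, zero_mul, cutoff, if_neg ht]
  have hexp : M.exchangeExpense T' (χ.stopAt T) ω = M.exchangeExpense T χ ω := by
    rw [exchangeExpense, exchangeExpense, hprice]
    by_cases h : TimeIntegrable (fun t => χ.ξ t ω * M.exchangePrice χ t ω) T
    · rw [if_pos h, if_pos ((timeIntegrable_cutoff_iff hT).2 h), timeIntegral_cutoff hT h]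
    · rw [if_neg h, if_neg (mt (timeIntegrable_cutoff_iff hT).1 h)]
  have hdark : ∀ i ∈ Finset.range (M.N (χ.ρ ω) ω),
      M.darkPrice (χ.stopAt T) i ω = M.darkPrice χ i ω := fun i hi => by
    have h1 : M.τ i ω ≤ T := ((M.lt_N_iff _ ω i).1 (Finset.mem_range.1 hi)).trans hρ.le
    have h2 : timeIntegral (fun s => (χ.stopAt T).ξ s ω) (M.τ i ω)
        = timeIntegral (fun s => χ.ξ s ω) (M.τ i ω) := timeIntegral_cutoff_of_le h1
    rw [darkPrice, darkPrice, h2, hκ, zero_mul, zero_mul]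
  rw [cost, cost, hexp, hα]
  simp only [zero_mul]
  congr 3
  refine Finset.sum_congr rfl fun i hi => ?_
  rw [← hdark i hi]
  rfl

lemma antitone_infExpectedCost (hα : M.α = 0) (hκ : M.κ = 0) (X₀ : ℝ) :
    Antitone (M.infExpectedCost X₀) := by
  intro T T' hT
  refine le_iInf fun χ => (iInf_le _ ⟨χ.1.stopAt T, χ.2.stopAt hT⟩).trans (le_of_eq ?_)
  exact expectation_congr (χ.2.lt_horizon.mono fun ω hω => cost_stopAt hα hκ hT hω)

end Model
end DarkPool

/-! ### Optimisation over the size of the dark-pool order. -/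

theorem mainTheorem8 {Ω : Type*} [MeasurableSpace Ω] (μ : Measure Ω) [IsProbabilityMeasure μ]
    (M : DarkPool.Model μ) (θ : ℝ≥0) (ν : Measure ℝ≥0∞) (hM : M.PoissonArrivals θ ν)
    (hα : M.α = 0) (hβ : ∀ y, M.β y = 0) (hκ : M.κ = 0) (η : ℝ) (hη : ∀ x, M.h x = η * x) :
    (M.γ / η < 2 * (θ : ℝ) → ∀ X₀ : ℝ, X₀ ≠ 0 →
      ∃ L : EReal, Tendsto (fun T : ℝ≥0 => M.infExpectedCost X₀ T) atTop (𝓝 L) ∧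
        L ≤ ((-(M.γ ^ 2 / 2) * X₀ ^ 2 * (1 / (2 * η * θ - M.γ)) : ℝ) : EReal) ∧
        -(M.γ ^ 2 / 2) * X₀ ^ 2 * (1 / (2 * η * θ - M.γ)) < 0) ∧
    (∀ X₀ : ℝ, (M.γ / η = 2 * (θ : ℝ) ∧ X₀ ≠ 0) ∨ 2 * (θ : ℝ) < M.γ / η →
      Tendsto (fun T : ℝ≥0 => M.infExpectedCost X₀ T) atTop (𝓝 ⊥)) := by
  -- Positivity of `η` is encoded in the strict monotonicity of the impact function.
  have hη0 : 0 < η := by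
    have h := M.impact.strictMono one_pos
    rw [M.impact.map_zero, hη, mul_one] at h
    exact h
  have hθ : (0 : ℝ) < θ := hM.θ_pos
  have hγ := M.γ_pos
  have hlim : ∀ X₀ : ℝ, Tendsto (fun T : ℝ≥0 => M.infExpectedCost X₀ T) atTop
      (𝓝 (⨅ T, M.infExpectedCost X₀ T)) := fun X₀ =>
    tendsto_atTop_iInf (DarkPool.Model.antitone_infExpectedCost hα hκ X₀)
  have hle := fun X₀ x hx => hM.iInf_infExpectedCost_le (x := x) hα hβ hκ hη0 hη X₀ hx
  refine ⟨fun hlt X₀ hX₀ => ⟨_, hlim X₀, ?_, ?_⟩, fun X₀ hX => ?_⟩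
  · rw [div_lt_iff₀ hη0] at hlt
    have hd : 0 < 2 * η * θ - M.γ := by linarith
    -- This order size is the vertex of the quadratic in `x`, which is convex because `γ < 2ηθ`.
    have hx : -(2 * η * θ * X₀ / (2 * η * θ - M.γ)) ≠ 0 := by
      refine neg_ne_zero.2 (div_ne_zero ?_ hd.ne')
      positivity
    refine (hle X₀ _ hx).trans (EReal.coe_le_coe_iff.2 (le_of_eq ?_))
    field_simp
    ring
  · rw [div_lt_iff₀ hη0] at hlt
    have hd : 0 < 2 * η * θ - M.γ := by linarith
    have : 0 < M.γ ^ 2 / 2 * X₀ ^ 2 * (1 / (2 * η * θ - M.γ)) := by positivity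
    linarith
  · have hbot : ⨅ T, M.infExpectedCost X₀ T = ⊥ := by
      rw [EReal.eq_bot_iff_forall_lt]
      intro y
      obtain ⟨x, hx0, hx⟩ : ∃ x : ℝ, x ≠ 0 ∧
          M.γ / 2 * (X₀ + x) ^ 2 - M.γ ^ 2 * x ^ 2 / (4 * η * θ) < y := by
        have hexp : ∀ x : ℝ, M.γ / 2 * (X₀ + x) ^ 2 - M.γ ^ 2 * x ^ 2 / (4 * η * θ)
            = M.γ / 2 * X₀ ^ 2 + x * (M.γ * X₀
              + x * (M.γ / 2 * (1 - M.γ / η / (2 * θ)))) := fun x => by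
          field_simp
          ring
        simp only [hexp]
        rcases hX with ⟨heq, hX₀⟩ | hgt
        -- In the critical case the quadratic term vanishes; with `x = -r X₀` the linear term is `-γ
        -- X₀² r`, which tends to `-∞` as `r → ∞`.
        · have h1 : 1 - M.γ / η / (2 * θ) = 0 := by
            rw [heq, div_self (by positivity), sub_self]
          have h2 : Tendsto (fun r : ℝ => M.γ / 2 * X₀ ^ 2 + -(M.γ * X₀ ^ 2) * r) atTop atBot :=
            tendsto_atBot_add_const_left _ _
              (tendsto_id.const_mul_atTop_of_neg (by simp only [neg_lt_zero]; positivity))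
          obtain ⟨r, hr, hr0⟩ := ((h2.eventually_lt_atBot y).and (eventually_gt_atTop 0)).exists
          refine ⟨-(r * X₀), neg_ne_zero.2 (mul_ne_zero hr0.ne' hX₀), ?_⟩
          rw [h1]
          refine lt_of_eq_of_lt ?_ hr
          ring
        -- Here the leading coefficient is negative, so large positive `x` works even for `X₀ = 0`.
        · have h1 : M.γ / 2 * (1 - M.γ / η / (2 * θ)) < 0 := by
            refine mul_neg_of_pos_of_neg (by positivity) ?_
            rw [sub_neg, lt_div_iff₀ (by positivity), one_mul]
            exact hgt
          have h2 : Tendsto (fun x : ℝ => M.γ / 2 * X₀ ^ 2 + x * (M.γ * X₀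
              + x * (M.γ / 2 * (1 - M.γ / η / (2 * θ))))) atTop atBot :=
            tendsto_atBot_add_const_left _ _ (tendsto_id.atTop_mul_atBot₀
              (tendsto_atBot_add_const_left _ _ (tendsto_id.atTop_mul_const_of_neg h1)))
          obtain ⟨x, hx, hx0⟩ := ((h2.eventually_lt_atBot y).and (eventually_gt_atTop 0)).exists
          exact ⟨x, hx0.ne', hx⟩
      exact (hle X₀ x hx0).trans_lt (EReal.coe_lt_coe_iff.2 hx)
    rw [← hbot]
    exact hlim X₀
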